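/- Let $N\ge 2$, $1<p<\infty$, $0<s<1$, and let $\Omega\subset\mathbb{R}^N$ be a bounded $C^1$ domain. Let $H:\mathbb{R}^N\to[0,\infty)$ be a Finsler–Minkowski norm: $H$ is convex, its unit ball $\{H\le 1\}$ is strictly convex, $H\in C^1(\mathbb{R}^N\setminus\{0\})$, $H(\xi)=0$ iff $\xi=0$, $H(t\xi)=|t|H(\xi)$ for all $t\in\mathbb{R}$, $\xi\in\mathbb{R}^N$, and there are constants $C_1,C_2>0$ with $C_1|\xi|\le H(\xi)\le C_2|\xi|$ for all $\xi\in\mathbb{R}^N$. Let $f:\Omega\times[0,\infty)\to\mathbb{R}$ satisfy: (f1) $f$ is a Carathéodory function ($f(\cdot,t)$ is measurable for every $t\ge0$, and $f(x,\cdot)$ is continuous on $[0,\infty)$ for a.e. $x\in\Omega$); (f2) $f(\cdot,t)\in L^\infty(\Omega)$ for every $t\ge 0$; (f3) there is a constant $c_p>0$ such that $|f(x,t)|\le c_p(1+t^{p-1})$ for a.e. $x\in\Omega$ and every $t\ge0$; (f4) for a.e. $x\in\Omega$, the function $t\mapsto f(x,t)/t^{p-1}$ is strictly decreasing on $(0,\infty)$;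 (f5) there is $\rho_f>0$ such that $f(x,t)>0$ for a.e. $x\in\Omega$ and every $0<t<\rho_f$. Let $W_0^{1,p}(\Omega)=\{u\in W^{1,p}(\mathbb{R}^N): u=0 \text{ a.e. in }\mathbb{R}^N\setminus\Omega\}$. A function $u\in W_0^{1,p}(\Omega)$ is called a weak solution of the mixed Brezis–Oswald problem $$-\operatorname{div}\big(H(\nabla u)^{p-1}\nabla H(\nabla u)\big)+(-\Delta_p)^su=f(x,u)\ \text{ in }\Omega,\qquad u\gneqq 0\ \text{ in }\Omega,\qquad u=0\ \text{ in }\mathbb{R}^N\setminus\Omega,$$ if $u\ge0$ a.e. in $\Omega$, $|\{x\in\Omega:u(x)>0\}|>0$, and for every $\varphi\in W_0^{1,p}(\Omega)$ $$\int_\Omega H(\nabla u)^{p-1}\nabla H(\nabla u)\cdot\nabla\varphi\,dx+\iint_{\mathbb{R}^{N}\times\mathbb{R}^N}\frac{|u(x)-u(y)|^{p-2}(u(x)-u(y))(\varphi(x)-\varphi(y))}{|x-y|^{N+ps}}\,dx\,dy=\int_\Omega f(x,u)\,\varphi\,dx ,$$ where $H(\xi)^{p-1}\nabla H(\xi)$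 is understood as $0$ at $\xi=0$. Then this problem has at most one weak solution in $W_0^{1,p}(\Omega)$: any two weak solutions coincide a.e. -/

import Mathlib

open MeasureTheory Set
open scoped ContDiff ENNReal

namespace BrezisOswald

/-- Euclidean space `ℝ^N` with its Lebesgue measure. -/
abbrev E (N : ℕ) : Type := EuclideanSpace ℝ (Fin N)

/-- A bounded `C¹` domain: a bounded, nonempty, connected open set which near each of its boundary
points is, in suitable orthonormal coordinates, the strict epigraph of a `C¹` function of `N - 1`
variables (the last coordinate axis is spanned by `ν`, the others span its orthogonal complement). -/
structure IsBoundedC1Domain {N : ℕ} (Ω : Set (E N)) : Prop where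
  isOpen : IsOpen Ω
  isConnected : IsConnected Ω
  isBounded : Bornology.IsBounded Ω
  boundary : ∀ x ∈ frontier Ω, ∃ r : ℝ, 0 < r ∧ ∃ ν : E N, ‖ν‖ = 1 ∧
    ∃ γ : (Submodule.span ℝ {ν})ᗮ → ℝ, ContDiff ℝ 1 γ ∧
      ∀ y ∈ Metric.ball x r,
        (y ∈ Ω ↔ γ ((Submodule.span ℝ {ν})ᗮ.orthogonalProjectionOnto y) < inner ℝ ν y)

/-- Finsler–Minkowski norms. A `1`-homogeneous function is affine on rays, so strict convexity is
meant, as for norms, as strict convexity of the unit ball. -/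
structure IsFinslerMinkowskiNorm {N : ℕ} (H : E N → ℝ) : Prop where
  nonneg : ∀ ξ, 0 ≤ H ξ
  convexOn : ConvexOn ℝ univ H
  strictConvex : StrictConvex ℝ {ξ | H ξ ≤ 1}
  contDiffOn : ContDiffOn ℝ 1 H {0}ᶜ
  eq_zero_iff : ∀ ξ, H ξ = 0 ↔ ξ = 0
  homogeneous : ∀ (t : ℝ) (ξ : E N), H (t • ξ) = |t| * H ξ
  comparable : ∃ C₁ C₂ : ℝ, 0 < C₁ ∧ 0 < C₂ ∧ ∀ ξ, C₁ * ‖ξ‖ ≤ H ξ ∧ H ξ ≤ C₂ * ‖ξ‖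

/-- `G` is a weak gradient of `u` on `ℝ^N` (unique up to a null set). -/
structure IsWeakGradient {N : ℕ} (u : E N → ℝ) (G : E N → E N) : Prop where
  locallyIntegrable : LocallyIntegrable u volume
  locallyIntegrable_grad : LocallyIntegrable G volume
  integral_eq : ∀ φ : E N → ℝ, ContDiff ℝ ∞ φ → HasCompactSupport φ → ∀ e : E N,
    ∫ x, u x * fderiv ℝ φ x e = - ∫ x, φ x * inner ℝ (G x) e

/-- `W₀^{1,p}(Ω) = {u ∈ W^{1,p}(ℝ^N) : u = 0 a.e. in ℝ^N ∖ Ω}`. -/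
structure MemW0 {N : ℕ} (p : ℝ) (Ω : Set (E N)) (u : E N → ℝ) : Prop where
  memLp : MemLp u (ENNReal.ofReal p) volume
  exists_grad : ∃ G : E N → E N, IsWeakGradient u G ∧ MemLp G (ENNReal.ofReal p) volume
  eq_zero : ∀ᵐ x ∂(volume : Measure (E N)), x ∉ Ω → u x = 0

/-- The hypotheses (f1)–(f5) on the nonlinearity; only the values `f x t` with `x ∈ Ω` and `0 ≤ t`
are involved. -/
structure IsAdmissible {N : ℕ} (p : ℝ) (Ω : Set (E N)) (f : E N → ℝ → ℝ) : Prop where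
  measurable : ∀ t : ℝ, 0 ≤ t → AEMeasurable (fun x => f x t) (volume.restrict Ω)
  continuous : ∀ᵐ x ∂(volume.restrict Ω), ContinuousOn (f x) (Ici 0)
  bounded : ∀ t : ℝ, 0 ≤ t → MemLp (fun x => f x t) ⊤ (volume.restrict Ω)
  growth : ∃ c : ℝ, 0 < c ∧
    ∀ᵐ x ∂(volume.restrict Ω), ∀ t : ℝ, 0 ≤ t → |f x t| ≤ c * (1 + t ^ (p - 1))
  strictAnti : ∀ᵐ x ∂(volume.restrict Ω), StrictAntiOn (fun t : ℝ => f x t / t ^ (p - 1)) (Ioi 0)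
  pos : ∃ ρ : ℝ, 0 < ρ ∧ ∀ᵐ x ∂(volume.restrict Ω), ∀ t : ℝ, 0 < t → t < ρ → 0 < f x t

/-- `∫_Ω H(Gu)^{p-1} ∇H(Gu) · Gφ dx`, where `Gu`, `Gφ` stand for the weak gradients of `u`, `φ`.
The field `H^{p-1} ∇H` takes its continuous value `0` at the origin. -/
noncomputable def localForm {N : ℕ} (p : ℝ) (Ω : Set (E N)) (H : E N → ℝ)
    (Gu Gφ : E N → E N) : ℝ :=
  ∫ x in Ω, H (Gu x) ^ (p - 1) * inner ℝ (gradient H (Gu x)) (Gφ x)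

/-- `∬ |u(x)-u(y)|^{p-2} (u(x)-u(y)) (φ(x)-φ(y)) |x-y|^{-N-ps} dx dy` over `ℝ^N × ℝ^N`. -/
noncomputable def nonlocalForm {N : ℕ} (p s : ℝ) (u φ : E N → ℝ) : ℝ :=
  ∫ z : E N × E N, |u z.1 - u z.2| ^ (p - 2) * (u z.1 - u z.2) * (φ z.1 - φ z.2)
    * ‖z.1 - z.2‖ ^ (-(N : ℝ) - p * s) ∂((volume : Measure (E N)).prod volume)

/-- Weak solutions of `-H_p u + (-Δ_p)^s u = f(x,u)` in `Ω`, `u ≩ 0` in `Ω`, `u = 0` outside `Ω`. -/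
structure IsWeakSolution {N : ℕ} (p s : ℝ) (Ω : Set (E N)) (H : E N → ℝ) (f : E N → ℝ → ℝ)
    (u : E N → ℝ) : Prop where
  mem : MemW0 p Ω u
  weak_eq : ∀ φ : E N → ℝ, MemW0 p Ω φ →
    ∀ Gu Gφ : E N → E N, IsWeakGradient u Gu → IsWeakGradient φ Gφ →
      localForm p Ω H Gu Gφ + nonlocalForm p s u φ = ∫ x in Ω, f x (u x) * φ x
  nonneg : ∀ᵐ x ∂(volume.restrict Ω), 0 ≤ u x
  pos : 0 < volume {x | x ∈ Ω ∧ 0 < u x}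

end BrezisOswald

/-!
The uniqueness proof rests on the hidden convexity of the energy
`A(u) = (1/p) ∫_Ω H(∇u)^p + (1/p) ∬ |u(x)-u(y)|^p |x-y|^{-N-ps}` along the power means
`σ_t = ((1-t) u^p + t w^p)^{1/p}` of two nonnegative functions.

For weak solutions `u`, `w`, the power mean `σ_t` again belongs to `W₀^{1,p}(Ω)`
(`IsWeakGradient.pmean`), because the power mean is a norm on the quadrant, and both parts of the
energy satisfy `A(σ_t) ≤ (1-t) A(u) + t A(w) - (1/p) ∬ slack_t`, where the slack, nonnegative by
`abs_pmean_sub_rpow_le`, measures the defect in the discrete inequality. On the other hand `A` is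
convex in the usual sense, so testing the equation for `u` with `σ_t - u` gives
`∫_Ω f(x,u) (σ_t - u) ≤ A(σ_t) - A(u)`. Hence
`∫_Ω f(x,u) (σ_t - u)/t + (1/p) ∬ slack_t/t ≤ A(w) - A(u)`
(`IsWeakSolution.integral_diffQuotient_add_le`). No quotient such as `w^p / u^{p-1}` is used as a
test function, so neither regularity nor lower bounds for `u` are needed.

The growth of `f` and its positivity near `0` provide an integrable minorant of `f(x,u)(σ_t - u)/t`
that is uniform in `t` (`IsAdmissible.exists_minorant`), so that Fatou's lemma applies in two ways.
With `t = τ^p` the slack between a point where `u = 0 < w` and a point where `u > 0` is of exact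
order `τ`, which is much larger than `t`. Thus `{u = 0 < w}` is a null set
(`IsWeakSolution.ae_eq_zero_imp`), which stands in for the strong maximum principle. Next, adding
the inequalities for `(u,w)` and `(w,u)` cancels the energies, and the limit `t → 0` yields
`∫_Ω (f(x,u)/u^{p-1} - f(x,w)/w^{p-1}) (w^p - u^p) ≤ 0`. The integrand is positive wherever
`u ≠ w`, so `u = w` almost everywhere (`IsWeakSolution.ae_eq`).

The Sobolev facts used are proved by mollification: the chain rule for power means, and the
embedding of `W^{1,p}(ℝ^N)` into `W^{s,p}(ℝ^N)` (`IsWeakGradient.integrable_gagliardo`), which makes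
the nonlocal energy finite.
-/

namespace BrezisOswald

open Filter Topology
open scoped Convolution

/-! ### Integration lemmas -/

theorem rpow_lintegral_le_lintegral_rpow {α : Type*} [MeasurableSpace α] {ν : Measure α}
    [IsProbabilityMeasure ν] {g : α → ℝ≥0∞} (hg : AEMeasurable g ν) {p : ℝ} (hp : 1 ≤ p) :
    (∫⁻ t, g t ∂ν) ^ p ≤ ∫⁻ t, g t ^ p ∂ν := by
  have h := eLpNorm'_le_eLpNorm'_of_exponent_le (f := g) (μ := ν) zero_lt_one hp
    hg.aestronglyMeasurable
  simp only [eLpNorm', enorm_eq_self, ENNReal.rpow_one, div_one] at h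
  calc (∫⁻ t, g t ∂ν) ^ p ≤ ((∫⁻ t, g t ^ p ∂ν) ^ (1 / p)) ^ p := by gcongr
    _ = _ := by rw [← ENNReal.rpow_mul, one_div_mul_cancel (by positivity), ENNReal.rpow_one]

/-- An average of translates of `g` has no larger `L^p` norm than `g`. -/
theorem lintegral_rpow_average_translates_le {N : ℕ} {T : Type*} [MeasurableSpace T]
    {ν : Measure T} [IsProbabilityMeasure ν] {g : E N → ℝ≥0∞} (hg : Measurable g)
    {τ : T → E N} (hτ : Measurable τ) {p : ℝ} (hp : 1 ≤ p) :
    ∫⁻ x, (∫⁻ t, g (x + τ t) ∂ν) ^ p ≤ ∫⁻ x, g x ^ p := by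
  calc ∫⁻ x, (∫⁻ t, g (x + τ t) ∂ν) ^ p ≤ ∫⁻ x, ∫⁻ t, g (x + τ t) ^ p ∂ν := by
        refine lintegral_mono fun x => rpow_lintegral_le_lintegral_rpow ?_ hp
        exact (hg.comp (measurable_const.add hτ)).aemeasurable
    _ = ∫⁻ t, ∫⁻ x, g (x + τ t) ^ p ∂volume ∂ν := by
        refine lintegral_lintegral_swap (Measurable.aemeasurable ?_)
        exact (hg.comp (measurable_fst.add (hτ.comp measurable_snd))).pow_const p
    _ = ∫⁻ t, ∫⁻ x, g x ^ p ∂volume ∂ν := by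
        refine lintegral_congr fun t => ?_
        exact lintegral_add_right_eq_self (fun x => g x ^ p) (τ t)
    _ = ∫⁻ x, g x ^ p := by simp

/-- Vitali's convergence theorem, with uniform integrability provided by an `L^p` bound,
`p > 1`. -/
theorem tendsto_integral_of_ae_of_eLpNorm_le {α : Type*} [MeasurableSpace α] {μ : Measure α}
    [IsFiniteMeasure μ] {p : ℝ} (hp : 1 < p) {f : ℕ → α → ℝ} {g : α → ℝ}
    (hf : ∀ n, AEStronglyMeasurable (f n) μ) {C : ℝ≥0∞} (hC : C ≠ ⊤)
    (hbd : ∀ n, eLpNorm (f n) (ENNReal.ofReal p) μ ≤ C)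
    (hlim : ∀ᵐ x ∂μ, Tendsto (fun n => f n x) atTop (𝓝 (g x))) :
    Tendsto (fun n => ∫ x, f n x ∂μ) atTop (𝓝 (∫ x, g x ∂μ)) := by
  have hp1 : (1 : ℝ≥0∞) ≤ ENNReal.ofReal p := by simpa using hp.le
  have hp0 : 0 < p := by linarith
  have hgm : AEStronglyMeasurable g μ := aestronglyMeasurable_of_tendsto_ae atTop hf hlim
  have hgbd : eLpNorm g (ENNReal.ofReal p) μ ≤ C := by
    refine (Lp.eLpNorm_lim_le_liminf_eLpNorm hf g hlim).trans ?_
    exact (liminf_le_liminf (Eventually.of_forall hbd)).trans (by simp)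
  have hfp : ∀ n, MemLp (f n) (ENNReal.ofReal p) μ :=
    fun n => ⟨hf n, (hbd n).trans_lt hC.lt_top⟩
  have hgp : MemLp g (ENNReal.ofReal p) μ := ⟨hgm, hgbd.trans_lt hC.lt_top⟩
  have hint : ∀ n, ∫⁻ x, ‖f n x‖ₑ ^ p ∂μ ≤ C ^ p := by
    intro n
    have h := hbd n
    rw [eLpNorm_eq_lintegral_rpow_enorm_toReal (by simpa using hp0) (by simp),
      ENNReal.toReal_ofReal hp0.le] at h
    calc ∫⁻ x, ‖f n x‖ₑ ^ p ∂μ = ((∫⁻ x, ‖f n x‖ₑ ^ p ∂μ) ^ (1 / p)) ^ p := by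
          rw [← ENNReal.rpow_mul, one_div_mul_cancel hp0.ne', ENNReal.rpow_one]
      _ ≤ C ^ p := by gcongr
  have hui : UnifIntegrable f 1 μ := by
    refine unifIntegrable_of le_rfl (by simp) hf fun ε hε => ?_
    -- On `{|f| ≥ M}` one has `|f| ≤ M ^ (1 - p) |f| ^ p`.
    have htend : Tendsto (fun M : ℝ => M ^ (-(p - 1)) * (C ^ p).toReal) atTop (𝓝 0) := by
      simpa using (tendsto_rpow_neg_atTop (by linarith : 0 < p - 1)).mul_const (C ^ p).toReal
    obtain ⟨M, hM, hM1⟩ := ((htend.eventually (gt_mem_nhds hε)).and (eventually_ge_atTop 1)).exists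
    have hM0 : 0 < M := by linarith
    refine ⟨M.toNNReal, fun n => ?_⟩
    have hCp : C ^ p ≠ ⊤ := ENNReal.rpow_ne_top_of_nonneg hp0.le hC
    rw [eLpNorm_one_eq_lintegral_enorm]
    calc ∫⁻ x, ‖{x | M.toNNReal ≤ ‖f n x‖₊}.indicator (f n) x‖ₑ ∂μ
        ≤ ∫⁻ x, ENNReal.ofReal (M ^ (-(p - 1))) * ‖f n x‖ₑ ^ p ∂μ := by
          refine lintegral_mono fun x => ?_
          by_cases hx : x ∈ {x | M.toNNReal ≤ ‖f n x‖₊}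
          · have hx' : M ≤ |f n x| := by
              have : M.toNNReal ≤ ‖f n x‖₊ := hx
              rw [Real.toNNReal_le_iff_le_coe] at this
              simpa using this
            have hpos : 0 < |f n x| := by linarith
            simp only [indicator_of_mem hx]
            rw [← ofReal_norm, ENNReal.ofReal_rpow_of_nonneg (norm_nonneg _) hp0.le,
              ← ENNReal.ofReal_mul (by positivity), Real.norm_eq_abs]
            refine ENNReal.ofReal_le_ofReal ?_
            calc |f n x| = |f n x| ^ (-(p - 1)) * |f n x| ^ p := by
                  rw [← Real.rpow_add hpos]; simp
              _ ≤ _ := by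
                  gcongr ?_ * _
                  exact Real.rpow_le_rpow_of_nonpos hM0 hx' (by linarith)
          · simp [indicator_of_notMem hx]
      _ = ENNReal.ofReal (M ^ (-(p - 1))) * ∫⁻ x, ‖f n x‖ₑ ^ p ∂μ := by
          rw [lintegral_const_mul' _ _ (by simp)]
      _ ≤ ENNReal.ofReal (M ^ (-(p - 1))) * ENNReal.ofReal (C ^ p).toReal := by
          rw [ENNReal.ofReal_toReal hCp]; gcongr; exact hint n
      _ ≤ ENNReal.ofReal ε := by
          rw [← ENNReal.ofReal_mul (by positivity)]; exact ENNReal.ofReal_le_ofReal hM.le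
  have hL1 := tendsto_Lp_finite_of_tendsto_ae le_rfl (by simp) hf (hgp.mono_exponent hp1) hui hlim
  exact tendsto_integral_of_L1' g hgm
    (Eventually.of_forall fun n => (hfp n).integrable hp1) hL1

/-- Fatou's lemma for integrals, with an integrable minorant. -/
theorem integrable_and_integral_le_of_tendsto {α : Type*} [MeasurableSpace α] {μ : Measure α}
    {F : ℕ → α → ℝ} {L G : α → ℝ} {c : ℕ → ℝ} {a : ℝ} (hF : ∀ n, Integrable (F n) μ)
    (hL : Integrable L μ) (hLF : ∀ n, ∀ᵐ x ∂μ, L x ≤ F n x)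
    (hlim : ∀ᵐ x ∂μ, Tendsto (fun n => F n x) atTop (𝓝 (G x)))
    (hc : ∀ n, ∫ x, F n x ∂μ ≤ c n) (hca : Tendsto c atTop (𝓝 a)) :
    Integrable G μ ∧ ∫ x, G x ∂μ ≤ a := by
  have hLF' := ae_all_iff.2 hLF
  have hLG : ∀ᵐ x ∂μ, L x ≤ G x := by
    filter_upwards [hLF', hlim] with x h1 h2
    exact ge_of_tendsto' h2 h1
  have hGm : AEStronglyMeasurable G μ :=
    aestronglyMeasurable_of_tendsto_ae atTop (fun n => (hF n).1) hlim
  have hi : ∀ n, Integrable (fun x => F n x - L x) μ := fun n => (hF n).sub hL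
  have hfat : ∫⁻ x, ENNReal.ofReal (G x - L x) ∂μ ≤ ENNReal.ofReal (a - ∫ x, L x ∂μ) := by
    calc ∫⁻ x, ENNReal.ofReal (G x - L x) ∂μ
        = ∫⁻ x, liminf (fun n => ENNReal.ofReal (F n x - L x)) atTop ∂μ := by
          refine lintegral_congr_ae ?_
          filter_upwards [hlim] with x hx
          exact ((ENNReal.continuous_ofReal.tendsto _).comp (hx.sub_const _)).liminf_eq.symm
      _ ≤ liminf (fun n => ∫⁻ x, ENNReal.ofReal (F n x - L x) ∂μ) atTop :=
          lintegral_liminf_le' fun n => (hi n).1.aemeasurable.ennreal_ofReal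
      _ ≤ liminf (fun n => ENNReal.ofReal (c n - ∫ x, L x ∂μ)) atTop := by
          refine liminf_le_liminf (Eventually.of_forall fun n => ?_)
          rw [← ofReal_integral_eq_lintegral_ofReal (hi n)]
          · rw [integral_sub (hF n) hL]
            exact ENNReal.ofReal_le_ofReal (by linarith [hc n])
          · filter_upwards [hLF n] with x hx
            simpa using hx
      _ = ENNReal.ofReal (a - ∫ x, L x ∂μ) :=
          ((ENNReal.continuous_ofReal.tendsto _).comp (hca.sub_const _)).liminf_eq
  have hnn : 0 ≤ᵐ[μ] fun x => G x - L x := by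
    filter_upwards [hLG] with x hx
    simpa using hx
  have hGL : Integrable (fun x => G x - L x) μ := by
    refine ⟨hGm.sub hL.1, ?_⟩
    rw [hasFiniteIntegral_iff_ofReal hnn]
    exact hfat.trans_lt ENNReal.ofReal_lt_top
  have hG : Integrable G μ := (hGL.add hL).congr (Eventually.of_forall fun x => by simp)
  refine ⟨hG, ?_⟩
  have hle : ∫ x, L x ∂μ ≤ a := by
    refine ge_of_tendsto' hca fun n => ?_
    exact (integral_mono_ae hL (hF n) (hLF n)).trans (hc n)
  rw [← ofReal_integral_eq_lintegral_ofReal hGL hnn,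
    ENNReal.ofReal_le_ofReal_iff (by linarith), integral_sub hG hL] at hfat
  linarith

/-! ### Mollification and weak gradients -/

/-- The radial bump function supported in the closed ball of radius `2 / (n + 1)`. The ratio of its
two radii is fixed, which gives almost everywhere convergence of the mollifications. -/
noncomputable def mollifier (N n : ℕ) : ContDiffBump (0 : E N) where
  rIn := 1 / (n + 1)
  rOut := 2 / (n + 1)
  rIn_pos := by positivity
  rIn_lt_rOut := by gcongr; norm_num

/-- The convolution of `g` with the `n`-th normalized bump function. -/
noncomputable def mollify {N : ℕ} {F : Type*} [NormedAddCommGroup F] [NormedSpace ℝ F]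
    (n : ℕ) (g : E N → F) : E N → F :=
  (mollifier N n).normed volume ⋆[ContinuousLinearMap.lsmul ℝ ℝ, volume] g

section mollify

variable {N : ℕ} {F : Type*} [NormedAddCommGroup F] [NormedSpace ℝ F]

theorem contDiff_mollify [CompleteSpace F] {g : E N → F} (hg : LocallyIntegrable g volume)
    (n : ℕ) : ContDiff ℝ ∞ (mollify n g) :=
  (mollifier N n).hasCompactSupport_normed.contDiff_convolution_left _
    (mollifier N n).contDiff_normed hg

theorem ae_tendsto_mollify [CompleteSpace F] {g : E N → F} (hg : LocallyIntegrable g volume) :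
    ∀ᵐ x, Tendsto (fun n => mollify n g x) atTop (𝓝 (g x)) := by
  refine ContDiffBump.ae_convolution_tendsto_right_of_locallyIntegrable (K := 2) ?_ ?_ hg
  · exact tendsto_const_div_atTop_nhds_zero_nat (2 : ℝ) |>.comp (tendsto_add_atTop_nat 1) |>.congr
      fun n => by simp [mollifier]
  · refine Eventually.of_forall fun n => le_of_eq ?_
    simp only [mollifier]; ring

theorem mollify_apply (n : ℕ) (g : E N → F) (x : E N) :
    mollify n g x = ∫ t, (mollifier N n).normed volume t • g (x - t) := rfl

theorem mollify_apply_swap (n : ℕ) (g : E N → F) (x : E N) :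
    mollify n g x = ∫ t, (mollifier N n).normed volume (x - t) • g t := by
  rw [mollify, convolution_eq_swap]; rfl

theorem mollify_nonneg {g : E N → ℝ} (hg : ∀ᵐ x, 0 ≤ g x) (n : ℕ) (x : E N) :
    0 ≤ mollify n g x := by
  rw [mollify_apply_swap]
  refine integral_nonneg_of_ae ?_
  filter_upwards [hg] with t ht
  exact mul_nonneg ((mollifier N n).nonneg_normed _) ht

theorem mollify_congr {g g' : E N → F} (h : g =ᵐ[volume] g') (n : ℕ) :
    mollify n g = mollify n g' := by
  ext x
  rw [mollify_apply_swap, mollify_apply_swap]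
  refine integral_congr_ae ?_
  filter_upwards [h] with t ht
  rw [ht]

theorem eLpNorm_mollify_le {g : E N → F} (hg : AEStronglyMeasurable g volume)
    {p : ℝ} (hp : 1 ≤ p) (n : ℕ) :
    eLpNorm (mollify n g) (ENNReal.ofReal p) volume ≤ eLpNorm g (ENNReal.ofReal p) volume := by
  have hp0 : 0 < p := by linarith
  wlog hgm : StronglyMeasurable g generalizing g
  · rw [mollify_congr hg.ae_eq_mk, eLpNorm_congr_ae hg.ae_eq_mk]
    exact this hg.stronglyMeasurable_mk.aestronglyMeasurable hg.stronglyMeasurable_mk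
  set η := (mollifier N n).normed (volume : Measure (E N))
  have hηm : Measurable fun t => ENNReal.ofReal (η t) :=
    (mollifier N n).continuous_normed.measurable.ennreal_ofReal
  -- Convolution with the bump function is an average of translates for the probability `η dx`.
  let ν : Measure (E N) := volume.withDensity fun t => ENNReal.ofReal (η t)
  have : IsProbabilityMeasure ν := ⟨by
    rw [withDensity_apply _ MeasurableSet.univ, Measure.restrict_univ,
      ← ofReal_integral_eq_lintegral_ofReal ((mollifier N n).integrable_normed)
        (Eventually.of_forall (mollifier N n).nonneg_normed), (mollifier N n).integral_normed]
    simp⟩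
  have hge : Measurable fun x => ‖g x‖ₑ := hgm.enorm
  rw [eLpNorm_eq_lintegral_rpow_enorm_toReal (by simpa using hp0) (by simp),
    eLpNorm_eq_lintegral_rpow_enorm_toReal (by simpa using hp0) (by simp),
    ENNReal.toReal_ofReal hp0.le]
  gcongr ?_ ^ (1 / p)
  refine le_trans (lintegral_mono fun x => ?_)
    (lintegral_rpow_average_translates_le (ν := ν) hge measurable_neg hp)
  gcongr ?_ ^ p
  rw [mollify_apply]
  refine (enorm_integral_le_lintegral_enorm _).trans ?_
  have hgx : Measurable fun t => ‖g (x + -t)‖ₑ :=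
    hge.comp (measurable_const.add measurable_neg)
  rw [lintegral_withDensity_eq_lintegral_mul _ hηm hgx]
  refine lintegral_mono fun t => ?_
  simp only [Pi.mul_apply, enorm_smul, ← sub_eq_add_neg]
  rw [Real.enorm_of_nonneg ((mollifier N n).nonneg_normed t)]

end mollify

/-- Mollification commutes with the weak gradient. -/
theorem IsWeakGradient.fderiv_mollify {N : ℕ} {u : E N → ℝ} {G : E N → E N}
    (h : IsWeakGradient u G) (n : ℕ) (x e : E N) :
    fderiv ℝ (mollify n u) x e = inner ℝ (mollify n G x) e := by
  set η := (mollifier N n).normed (volume : Measure (E N))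
  have hηc : ContDiff ℝ ∞ η := (mollifier N n).contDiff_normed
  have hηs : HasCompactSupport η := (mollifier N n).hasCompactSupport_normed
  have h1 := hηs.hasFDerivAt_convolution_right (ContinuousLinearMap.lsmul ℝ ℝ).flip
    h.locallyIntegrable (hηc.of_le (by simp)) x
  rw [convolution_flip] at h1
  have hφc : ContDiff ℝ ∞ fun y => η (x - y) := hηc.comp (contDiff_const.sub contDiff_id)
  have hφs : HasCompactSupport fun y => η (x - y) :=
    hηs.comp_homeomorph (Homeomorph.subLeft x)
  have h2 := h.integral_eq _ hφc hφs e
  have h3 : ∀ y, fderiv ℝ (fun y => η (x - y)) y e = - fderiv ℝ η (x - y) e := by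
    intro y
    have hd : HasFDerivAt (fun y => η (x - y))
        ((fderiv ℝ η (x - y)).comp (-ContinuousLinearMap.id ℝ (E N))) y :=
      ((hηc.differentiable (by simp)).differentiableAt.hasFDerivAt).comp y
        ((hasFDerivAt_id y).const_sub x)
    rw [hd.fderiv]; simp
  have hconv : HasFDerivAt (mollify n u) _ x := h1
  rw [hconv.fderiv, convolution_precompR_apply _ h.locallyIntegrable (hηs.fderiv ℝ)
    (hηc.continuous_fderiv (by simp)), convolution_def, mollify_apply_swap]
  have hint : Integrable fun t => η (x - t) • G t := by
    have := h.locallyIntegrable_grad.integrable_smul_left_of_hasCompactSupport hφc.continuous hφs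
    simpa using this
  rw [real_inner_comm, ← integral_inner hint e]
  simp only [h3, mul_neg, integral_neg, neg_inj] at h2
  simp only [ContinuousLinearMap.flip_apply, ContinuousLinearMap.lsmul_apply, smul_eq_mul,
    inner_smul_right]
  rw [← sub_eq_zero] at h2 ⊢
  rw [← h2]
  congr 2
  · funext t; rw [mul_comm]
  · funext t; rw [real_inner_comm]

theorem continuous_of_fderiv_eq_inner {N : ℕ} {v : E N → ℝ} {g : E N → E N}
    (hv : ContDiff ℝ 1 v) (hg : ∀ x e, fderiv ℝ v x e = inner ℝ (g x) e) : Continuous g := by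
  have : g = fun x => (InnerProductSpace.toDual ℝ (E N)).symm (fderiv ℝ v x) := by
    funext x
    refine ext_inner_right ℝ fun e => ?_
    rw [InnerProductSpace.toDual_symm_apply, hg]
  rw [this]
  exact (LinearIsometryEquiv.continuous _).comp (hv.continuous_fderiv (by simp))

theorem isWeakGradient_of_contDiff {N : ℕ} {v : E N → ℝ} {g : E N → E N} (hv : ContDiff ℝ 1 v)
    (hg : ∀ x e, fderiv ℝ v x e = inner ℝ (g x) e) : IsWeakGradient v g := by
  have hgc := continuous_of_fderiv_eq_inner hv hg
  refine ⟨hv.continuous.locallyIntegrable, hgc.locallyIntegrable, fun φ hφ hφs e => ?_⟩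
  have hφ' : Continuous fun x => fderiv ℝ φ x e :=
    (hφ.continuous_fderiv (by simp)).clm_apply continuous_const
  have hv' : Continuous fun x => fderiv ℝ v x e :=
    (hv.continuous_fderiv (by simp)).clm_apply continuous_const
  have hφ's : HasCompactSupport fun x => fderiv ℝ φ x e := hφs.fderiv_apply ℝ e
  rw [integral_mul_fderiv_eq_neg_fderiv_mul_of_integrable]
  · simp [hg, mul_comm]
  · exact (hv'.mul hφ.continuous).integrable_of_hasCompactSupport hφs.mul_left
  · exact (hv.continuous.mul hφ').integrable_of_hasCompactSupport hφ's.mul_left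
  · exact (hv.continuous.mul hφ.continuous).integrable_of_hasCompactSupport hφs.mul_left
  · exact fun x _ => (hv.differentiable (by simp)).differentiableAt
  · exact fun x _ => (hφ.differentiable (by simp)).differentiableAt

/-- Weak gradients are stable under almost everywhere convergence with `L^p` bounds, `p > 1`. -/
theorem isWeakGradient_of_tendsto {N : ℕ} {p : ℝ} (hp : 1 < p) {v : ℕ → E N → ℝ}
    {g : ℕ → E N → E N} {w : E N → ℝ} {k : E N → E N} (h : ∀ n, IsWeakGradient (v n) (g n))
    {C : ℝ≥0∞} (hC : C ≠ ⊤) (hv : ∀ n, eLpNorm (v n) (ENNReal.ofReal p) volume ≤ C)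
    (hg : ∀ n, eLpNorm (g n) (ENNReal.ofReal p) volume ≤ C)
    (hvw : ∀ᵐ x, Tendsto (fun n => v n x) atTop (𝓝 (w x)))
    (hgk : ∀ᵐ x, Tendsto (fun n => g n x) atTop (𝓝 (k x))) :
    IsWeakGradient w k ∧ MemLp w (ENNReal.ofReal p) volume ∧
      MemLp k (ENNReal.ofReal p) volume := by
  have hp1 : (1 : ℝ≥0∞) ≤ ENNReal.ofReal p := by simpa using hp.le
  have hvm : ∀ n, AEStronglyMeasurable (v n) volume :=
    fun n => (h n).locallyIntegrable.aestronglyMeasurable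
  have hgm : ∀ n, AEStronglyMeasurable (g n) volume :=
    fun n => (h n).locallyIntegrable_grad.aestronglyMeasurable
  have hw : MemLp w (ENNReal.ofReal p) volume := by
    refine ⟨aestronglyMeasurable_of_tendsto_ae atTop hvm hvw, ?_⟩
    refine (Lp.eLpNorm_lim_le_liminf_eLpNorm hvm w hvw).trans_lt ?_
    exact ((liminf_le_liminf (Eventually.of_forall hv)).trans (by simp)).trans_lt hC.lt_top
  have hk : MemLp k (ENNReal.ofReal p) volume := by
    refine ⟨aestronglyMeasurable_of_tendsto_ae atTop hgm hgk, ?_⟩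
    refine (Lp.eLpNorm_lim_le_liminf_eLpNorm hgm k hgk).trans_lt ?_
    exact ((liminf_le_liminf (Eventually.of_forall hg)).trans (by simp)).trans_lt hC.lt_top
  refine ⟨⟨hw.locallyIntegrable hp1, hk.locallyIntegrable hp1, fun φ hφ hφs e => ?_⟩, hw, hk⟩
  -- Both sides of the defining identity pass to the limit on the support of the test function.
  have key : ∀ (ψ : E N → ℝ) (a : ℕ → E N → ℝ) (b : E N → ℝ), Continuous ψ →
      HasCompactSupport ψ → (∀ n, AEStronglyMeasurable (a n) volume) →
      (∃ D : ℝ≥0∞, D ≠ ⊤ ∧ ∀ n, eLpNorm (a n) (ENNReal.ofReal p) volume ≤ D) →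
      (∀ᵐ x, Tendsto (fun n => a n x) atTop (𝓝 (b x))) →
      Tendsto (fun n => ∫ x, ψ x * a n x) atTop (𝓝 (∫ x, ψ x * b x)) := by
    rintro ψ a b hψ hψs ham ⟨D, hD, haD⟩ hab
    obtain ⟨M, hM⟩ := hψ.bounded_above_of_compact_support hψs
    have hset : ∀ c : E N → ℝ, ∫ x in tsupport ψ, ψ x * c x = ∫ x, ψ x * c x := fun c =>
      setIntegral_eq_integral_of_forall_compl_eq_zero fun x hx => by
        rw [image_eq_zero_of_notMem_tsupport hx, zero_mul]
    simp_rw [← hset]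
    have : IsFiniteMeasure (volume.restrict (tsupport ψ)) :=
      isFiniteMeasure_restrict.2 hψs.isCompact.measure_lt_top.ne
    refine tendsto_integral_of_ae_of_eLpNorm_le hp (C := ENNReal.ofReal M * D)
      (fun n => (hψ.aestronglyMeasurable.mul (ham n)).restrict)
      (ENNReal.mul_ne_top ENNReal.ofReal_ne_top hD) (fun n => ?_) ?_
    · refine (eLpNorm_mono_measure _ Measure.restrict_le_self).trans ?_
      refine (eLpNorm_le_mul_eLpNorm_of_ae_le_mul (c := M) (g := a n) ?_ _).trans ?_
      · refine Eventually.of_forall fun x => ?_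
        rw [norm_mul]
        gcongr
        exact hM x
      · gcongr
        exact haD n
    · refine ae_restrict_of_ae ?_
      filter_upwards [hab] with x hx
      exact hx.const_mul _
  have hφ' : Continuous fun x => fderiv ℝ φ x e :=
    (hφ.continuous_fderiv (by simp)).clm_apply continuous_const
  have t1 := key (fun x => fderiv ℝ φ x e) v w hφ' (hφs.fderiv_apply ℝ e) hvm ⟨C, hC, hv⟩ hvw
  have t2 := key φ (fun n x => inner ℝ (g n x) e) (fun x => inner ℝ (k x) e) hφ.continuous hφs
    (fun n => (hgm n).inner aestronglyMeasurable_const)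
    ⟨ENNReal.ofReal ‖e‖ * C, ENNReal.mul_ne_top ENNReal.ofReal_ne_top hC, fun n => by
      refine (eLpNorm_le_mul_eLpNorm_of_ae_le_mul (c := ‖e‖) (g := g n) ?_ _).trans ?_
      · refine Eventually.of_forall fun x => ?_
        rw [mul_comm]; exact norm_inner_le_norm _ _
      · gcongr
        exact hg n⟩
    (by filter_upwards [hgk] with x hx; exact hx.inner tendsto_const_nhds)
  have t3 : ∀ n, ∫ x, fderiv ℝ φ x e * v n x = -∫ x, φ x * inner ℝ (g n x) e := by
    intro n
    rw [← (h n).integral_eq φ hφ hφs e]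
    simp_rw [mul_comm]
  simp_rw [t3] at t1
  have := tendsto_nhds_unique t1 t2.neg
  simpa only [mul_comm] using this

theorem IsWeakGradient.sub {N : ℕ} {u v : E N → ℝ} {G K : E N → E N} (hu : IsWeakGradient u G)
    (hv : IsWeakGradient v K) : IsWeakGradient (fun x => u x - v x) fun x => G x - K x := by
  refine ⟨hu.locallyIntegrable.sub hv.locallyIntegrable,
    hu.locallyIntegrable_grad.sub hv.locallyIntegrable_grad, fun φ hφ hφs e => ?_⟩
  have hφ' : Continuous fun x => fderiv ℝ φ x e :=
    (hφ.continuous_fderiv (by simp)).clm_apply continuous_const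
  have i1 : ∀ {w : E N → ℝ}, LocallyIntegrable w volume →
      Integrable fun x => w x * fderiv ℝ φ x e := fun hw => by
    simpa [mul_comm] using
      hw.integrable_smul_left_of_hasCompactSupport hφ' (hφs.fderiv_apply ℝ e)
  have i2 : ∀ {W : E N → E N}, LocallyIntegrable W volume →
      Integrable fun x => φ x * inner ℝ (W x) e := fun {W} hW => by
    have := (hW.integrable_smul_left_of_hasCompactSupport hφ.continuous hφs).inner_const
      (𝕜 := ℝ) e
    simpa [inner_smul_left] using this
  simp only [sub_mul, inner_sub_left, mul_sub]
  rw [integral_sub (i1 hu.locallyIntegrable) (i1 hv.locallyIntegrable),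
    integral_sub (i2 hu.locallyIntegrable_grad) (i2 hv.locallyIntegrable_grad),
    hu.integral_eq φ hφ hφs e, hv.integral_eq φ hφ hφs e]
  ring

/-! ### Finiteness of the Gagliardo energy -/

theorem lintegral_translate_sub_le_of_contDiff {N : ℕ} {p : ℝ} (hp : 1 ≤ p) {v : E N → ℝ}
    {g : E N → E N} (hv : ContDiff ℝ 1 v) (hg : ∀ x e, fderiv ℝ v x e = inner ℝ (g x) e)
    (h : E N) :
    ∫⁻ x, ‖v (x + h) - v x‖ₑ ^ p ≤ ‖h‖ₑ ^ p * ∫⁻ x, ‖g x‖ₑ ^ p := by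
  have hp0 : 0 ≤ p := by linarith
  have hgc := continuous_of_fderiv_eq_inner hv hg
  have hpt : ∀ x, ‖v (x + h) - v x‖ₑ ≤ ‖h‖ₑ * ∫⁻ t in Ioc (0 : ℝ) 1, ‖g (x + t • h)‖ₑ := by
    intro x
    have hd : ∀ t : ℝ, HasDerivAt (fun t : ℝ => v (x + t • h)) (inner ℝ (g (x + t • h)) h) t := by
      intro t
      rw [← hg]
      have h1 : HasDerivAt (fun t : ℝ => x + t • h) h t := by
        simpa using ((hasDerivAt_id t).smul_const h).const_add x
      exact ((hv.differentiable (by simp)).differentiableAt.hasFDerivAt).comp_hasDerivAt t h1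
    have hc : Continuous fun t : ℝ => inner ℝ (g (x + t • h)) h := by fun_prop
    have hftc := intervalIntegral.integral_eq_sub_of_hasDerivAt (fun t _ => hd t)
      (hc.intervalIntegrable 0 1)
    simp only [one_smul, zero_smul, add_zero] at hftc
    rw [← hftc, intervalIntegral.integral_of_le zero_le_one]
    refine (enorm_integral_le_lintegral_enorm _).trans ?_
    rw [← lintegral_const_mul' _ _ (by simp)]
    refine lintegral_mono fun t => ?_
    rw [mul_comm, ← ofReal_norm, ← ofReal_norm, ← ofReal_norm,
      ← ENNReal.ofReal_mul (norm_nonneg _)]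
    exact ENNReal.ofReal_le_ofReal (norm_inner_le_norm _ _)
  have : IsProbabilityMeasure (volume.restrict (Ioc (0 : ℝ) 1)) := ⟨by simp⟩
  calc ∫⁻ x, ‖v (x + h) - v x‖ₑ ^ p
      ≤ ∫⁻ x, ‖h‖ₑ ^ p * (∫⁻ t in Ioc (0 : ℝ) 1, ‖g (x + t • h)‖ₑ) ^ p := by
        refine lintegral_mono fun x => ?_
        rw [← ENNReal.mul_rpow_of_nonneg _ _ hp0]
        gcongr
        exact hpt x
    _ = ‖h‖ₑ ^ p * ∫⁻ x, (∫⁻ t in Ioc (0 : ℝ) 1, ‖g (x + t • h)‖ₑ) ^ p := by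
        rw [lintegral_const_mul' _ _ (ENNReal.rpow_ne_top_of_nonneg hp0 (by simp))]
    _ ≤ _ := by
        refine mul_le_mul_right ?_ _
        exact lintegral_rpow_average_translates_le (ν := volume.restrict (Ioc (0 : ℝ) 1))
          hgc.measurable.enorm (by fun_prop : Measurable fun t : ℝ => t • h) hp

theorem lintegral_enorm_rpow_eq {α F : Type*} [MeasurableSpace α] [NormedAddCommGroup F]
    {μ : Measure α} {p : ℝ} (hp : 0 < p) (g : α → F) :
    ∫⁻ x, ‖g x‖ₑ ^ p ∂μ = eLpNorm g (ENNReal.ofReal p) μ ^ p := by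
  rw [eLpNorm_eq_lintegral_rpow_enorm_toReal (by simpa using hp) (by simp),
    ENNReal.toReal_ofReal hp.le, ← ENNReal.rpow_mul, one_div_mul_cancel hp.ne', ENNReal.rpow_one]

/-- Passage to the limit in the mollified estimate, by Fatou's lemma. -/
theorem IsWeakGradient.lintegral_translate_sub_le {N : ℕ} {p : ℝ} (hp : 1 ≤ p) {u : E N → ℝ}
    {G : E N → E N} (hu : IsWeakGradient u G) (h : E N) :
    ∫⁻ x, ‖u (x + h) - u x‖ₑ ^ p ≤ ‖h‖ₑ ^ p * ∫⁻ x, ‖G x‖ₑ ^ p := by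
  have hp0 : 0 < p := by linarith
  have hlim := ae_tendsto_mollify hu.locallyIntegrable
  have hlim' : ∀ᵐ x, Tendsto (fun n => mollify n u (x + h)) atTop (𝓝 (u (x + h))) :=
    (measurePreserving_add_right volume h).quasiMeasurePreserving.ae hlim
  have hc : ∀ n, Continuous (mollify n u) :=
    fun n => (contDiff_mollify hu.locallyIntegrable n).continuous
  calc ∫⁻ x, ‖u (x + h) - u x‖ₑ ^ p
      = ∫⁻ x, liminf (fun n => ‖mollify n u (x + h) - mollify n u x‖ₑ ^ p) atTop := by
        refine lintegral_congr_ae ?_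
        filter_upwards [hlim, hlim'] with x h1 h2
        exact (((ENNReal.continuous_rpow_const.comp continuous_enorm).tendsto _).comp
          (h2.sub h1)).liminf_eq.symm
    _ ≤ liminf (fun n => ∫⁻ x, ‖mollify n u (x + h) - mollify n u x‖ₑ ^ p) atTop := by
        refine lintegral_liminf_le fun n => ?_
        have := hc n
        exact (ENNReal.continuous_rpow_const.comp (continuous_enorm.comp (by fun_prop :
          Continuous fun x => mollify n u (x + h) - mollify n u x))).measurable
    _ ≤ liminf (fun _ : ℕ => ‖h‖ₑ ^ p * ∫⁻ x, ‖G x‖ₑ ^ p) atTop := by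
        refine liminf_le_liminf (Eventually.of_forall fun n => ?_)
        refine (lintegral_translate_sub_le_of_contDiff hp
          ((contDiff_mollify hu.locallyIntegrable n).of_le (by simp))
          (hu.fderiv_mollify n) h).trans ?_
        refine mul_le_mul_right ?_ _
        rw [lintegral_enorm_rpow_eq hp0, lintegral_enorm_rpow_eq hp0]
        gcongr
        exact eLpNorm_mollify_le hu.locallyIntegrable_grad.aestronglyMeasurable hp n
    _ = _ := by simp

/-- The kernel is integrable against `min (A |h|^p) B`: near the origin because `s < 1`, at infinity
because `s > 0`. -/
theorem lintegral_kernel_lt_top {N : ℕ} (hN : 1 ≤ N) {p s : ℝ} (hp : 0 < p) (hs₀ : 0 < s)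
    (hs₁ : s < 1) {A B : ℝ≥0∞} (hA : A ≠ ⊤) (hB : B ≠ ⊤) :
    ∫⁻ h : E N, ENNReal.ofReal (‖h‖ ^ (-(N : ℝ) - p * s)) * min (‖h‖ₑ ^ p * A) B < ⊤ := by
  have hdim : Module.finrank ℝ (E N) = N := by simp
  have hps : 0 < p * s := by positivity
  rw [← lintegral_add_compl _ (measurableSet_ball (x := (0 : E N)) (ε := 1))]
  refine ENNReal.add_lt_top.2 ⟨?_, ?_⟩
  · have hint : IntegrableOn (fun h : E N => ‖h‖ ^ (-((N : ℝ) + p * s - p)))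
        (Metric.ball 0 1) volume := by
      refine integrableOn_ball_of_norm_le_rpow (C := 1) (α := (N : ℝ) + p * s - p)
        (by omega) ?_ ?_ ?_
      · rw [hdim]; nlinarith
      · refine Eventually.of_forall fun h => ?_
        rw [one_mul, Real.norm_of_nonneg (by positivity)]
      · exact (measurable_norm.pow_const _).aestronglyMeasurable
    calc ∫⁻ h in Metric.ball (0 : E N) 1,
          ENNReal.ofReal (‖h‖ ^ (-(N : ℝ) - p * s)) * min (‖h‖ₑ ^ p * A) B
        ≤ ∫⁻ h in Metric.ball (0 : E N) 1, ENNReal.ofReal (‖h‖ ^ (-((N : ℝ) + p * s - p))) * A := by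
          refine lintegral_mono fun h => ?_
          refine (mul_le_mul_right (min_le_left _ _) _).trans ?_
          rw [← mul_assoc]
          gcongr ?_ * A
          rw [← ofReal_norm, ENNReal.ofReal_rpow_of_nonneg (norm_nonneg _) hp.le,
            ← ENNReal.ofReal_mul (by positivity)]
          rcases (norm_nonneg h).eq_or_lt with h0 | h0
          · simp [← h0, Real.zero_rpow hp.ne']
          · rw [← Real.rpow_add h0]
            apply le_of_eq; congr 2; ring
      _ = (∫⁻ h in Metric.ball (0 : E N) 1, ENNReal.ofReal (‖h‖ ^ (-((N : ℝ) + p * s - p)))) * A :=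
          lintegral_mul_const' _ _ hA
      _ < ⊤ := by
          refine ENNReal.mul_lt_top ?_ hA.lt_top
          rw [← hasFiniteIntegral_iff_ofReal (Eventually.of_forall fun h => by positivity)]
          exact hint.2
  · have hint : Integrable (fun h : E N => (1 + ‖h‖) ^ (-((N : ℝ) + p * s))) volume := by
      refine integrable_one_add_norm ?_
      rw [hdim]; linarith
    calc ∫⁻ h in (Metric.ball (0 : E N) 1)ᶜ,
          ENNReal.ofReal (‖h‖ ^ (-(N : ℝ) - p * s)) * min (‖h‖ₑ ^ p * A) B
        ≤ ∫⁻ h in (Metric.ball (0 : E N) 1)ᶜ, ENNReal.ofReal (2 ^ ((N : ℝ) + p * s)) *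
            ENNReal.ofReal ((1 + ‖h‖) ^ (-((N : ℝ) + p * s))) * B := by
          refine setLIntegral_mono' measurableSet_ball.compl fun h hh => ?_
          have h1 : 1 ≤ ‖h‖ := by simpa using hh
          refine (mul_le_mul_right (min_le_right _ _) _).trans ?_
          gcongr ?_ * B
          rw [← ENNReal.ofReal_mul (by positivity)]
          refine ENNReal.ofReal_le_ofReal ?_
          have hr : 0 ≤ (N : ℝ) + p * s := by positivity
          have : ((1 + ‖h‖) / 2) ^ ((N : ℝ) + p * s) ≤ ‖h‖ ^ ((N : ℝ) + p * s) := by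
            gcongr; linarith
          rw [show -(N : ℝ) - p * s = -((N : ℝ) + p * s) by ring, Real.rpow_neg (by positivity),
            Real.rpow_neg (by positivity)]
          rw [Real.div_rpow (by positivity) (by positivity)] at this
          have hpos : 0 < (1 + ‖h‖) ^ ((N : ℝ) + p * s) := by positivity
          have h2pos : (0 : ℝ) < 2 ^ ((N : ℝ) + p * s) := by positivity
          rw [inv_le_comm₀ (by positivity) (by positivity), mul_inv, inv_inv]
          calc _ = (1 + ‖h‖) ^ ((N : ℝ) + p * s) / 2 ^ ((N : ℝ) + p * s) := by
                rw [div_eq_mul_inv, mul_comm]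
            _ ≤ _ := this
      _ ≤ ∫⁻ h : E N, ENNReal.ofReal (2 ^ ((N : ℝ) + p * s)) *
            ENNReal.ofReal ((1 + ‖h‖) ^ (-((N : ℝ) + p * s))) * B := setLIntegral_le_lintegral _ _
      _ = ENNReal.ofReal (2 ^ ((N : ℝ) + p * s)) *
            (∫⁻ h : E N, ENNReal.ofReal ((1 + ‖h‖) ^ (-((N : ℝ) + p * s)))) * B := by
          rw [lintegral_mul_const' _ _ hB, lintegral_const_mul' _ _ (by simp)]
      _ < ⊤ := by
          refine ENNReal.mul_lt_top (ENNReal.mul_lt_top (by simp) ?_) hB.lt_top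
          rw [← hasFiniteIntegral_iff_ofReal (Eventually.of_forall fun h => by positivity)]
          exact hint.2

/-- `W^{1,p}(ℝ^N)` embeds into `W^{s,p}(ℝ^N)`: near the diagonal translations are controlled by the
gradient, away from it by the `L^p` norm. -/
theorem IsWeakGradient.integrable_gagliardo {N : ℕ} (hN : 1 ≤ N) {p s : ℝ} (hp : 1 < p)
    (hs₀ : 0 < s) (hs₁ : s < 1) {u : E N → ℝ} {G : E N → E N} (hu : IsWeakGradient u G)
    (hup : MemLp u (ENNReal.ofReal p) volume) (hGp : MemLp G (ENNReal.ofReal p) volume) :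
    Integrable (fun z : E N × E N =>
      |u z.1 - u z.2| ^ p * ‖z.1 - z.2‖ ^ (-(N : ℝ) - p * s)) (volume.prod volume) := by
  have hp0 : 0 < p := by linarith
  have hum : AEMeasurable u volume := hup.1.aemeasurable
  have hm : AEMeasurable (fun z : E N × E N =>
      |u z.1 - u z.2| ^ p * ‖z.1 - z.2‖ ^ (-(N : ℝ) - p * s)) (volume.prod volume) := by
    have h1 : AEMeasurable (fun z : E N × E N => |u z.1 - u z.2|) (volume.prod volume) := by
      have := (hup.1.comp_fst (ν := (volume : Measure (E N)))).sub
        (hup.1.comp_snd (μ := (volume : Measure (E N))))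
      exact this.norm.aemeasurable
    exact (h1.pow_const p).mul
      (((measurable_fst.sub measurable_snd).norm.pow_const _).aemeasurable)
  refine ⟨hm.aestronglyMeasurable, ?_⟩
  rw [hasFiniteIntegral_iff_ofReal (Eventually.of_forall fun z => by positivity)]
  have hA : ∫⁻ x, ‖G x‖ₑ ^ p ≠ ⊤ := by
    rw [lintegral_enorm_rpow_eq hp0]
    exact ENNReal.rpow_ne_top_of_nonneg hp0.le hGp.2.ne
  have hU : ∫⁻ x, ‖u x‖ₑ ^ p ≠ ⊤ := by
    rw [lintegral_enorm_rpow_eq hp0]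
    exact ENNReal.rpow_ne_top_of_nonneg hp0.le hup.2.ne
  set B : ℝ≥0∞ := 2 ^ (p - 1) * ((∫⁻ x, ‖u x‖ₑ ^ p) + ∫⁻ x, ‖u x‖ₑ ^ p)
  have hB : B ≠ ⊤ := ENNReal.mul_ne_top
    (ENNReal.rpow_ne_top_of_nonneg (by linarith) (by simp)) (ENNReal.add_ne_top.2 ⟨hU, hU⟩)
  have hbd : ∀ h : E N, ∫⁻ x, ‖u (x + h) - u x‖ₑ ^ p ≤ B := by
    intro h
    calc ∫⁻ x, ‖u (x + h) - u x‖ₑ ^ p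
        ≤ ∫⁻ x, 2 ^ (p - 1) * (‖u (x + h)‖ₑ ^ p + ‖u x‖ₑ ^ p) := by
          refine lintegral_mono fun x => ?_
          refine le_trans ?_ (ENNReal.rpow_add_le_mul_rpow_add_rpow _ _ hp.le)
          gcongr
          exact enorm_sub_le
      _ = B := by
          rw [lintegral_const_mul' _ _ (ENNReal.rpow_ne_top_of_nonneg (by linarith) (by simp)),
            lintegral_add_right' _ (hum.enorm.pow_const p),
            lintegral_add_right_eq_self (fun x => ‖u x‖ₑ ^ p) h]
  refine lt_of_le_of_lt ?_ (lintegral_kernel_lt_top hN hp0 hs₀ hs₁ hA hB)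
  -- Substitute `(x, h) ↦ (x, x + h)`, so that the inner integral is over translates by `h`.
  have hmp := measurePreserving_prod_add (volume : Measure (E N)) (volume : Measure (E N))
  rw [← hmp.lintegral_comp_emb (MeasurableEquiv.shearAddRight (E N)).measurableEmbedding,
    lintegral_prod_symm]
  · refine lintegral_mono fun h => ?_
    have : ∀ x : E N, ENNReal.ofReal (|u x - u (x + h)| ^ p *
        ‖x - (x + h)‖ ^ (-(N : ℝ) - p * s)) =
        ENNReal.ofReal (‖h‖ ^ (-(N : ℝ) - p * s)) * ‖u (x + h) - u x‖ₑ ^ p := by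
      intro x
      rw [sub_add_cancel_left, norm_neg, mul_comm, ENNReal.ofReal_mul (by positivity),
        ← ofReal_norm, Real.norm_eq_abs, abs_sub_comm,
        ENNReal.ofReal_rpow_of_nonneg (abs_nonneg _) hp0.le]
    simp only [this]
    rw [lintegral_const_mul' _ _ (by simp)]
    gcongr
    exact le_min (hu.lintegral_translate_sub_le hp.le h) (hbd h)
  · exact (hm.comp_quasiMeasurePreserving hmp.quasiMeasurePreserving).ennreal_ofReal

/-! ### Weighted power means -/

/-- The weighted power mean `(l a ^ p + m b ^ p) ^ (1 / p)`. -/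
noncomputable def pmean (p l m a b : ℝ) : ℝ := (l * a ^ p + m * b ^ p) ^ (1 / p)

/-- The partial derivative of a power mean with respect to the entry `c` of weight `l`, where `M` is
the value of the mean. At the origin, where the power mean is not differentiable, it is given the
value `l` that it has on the diagonal. -/
noncomputable def pmeanCoef (p l M c : ℝ) : ℝ := if M = 0 then l else l * (c / M) ^ (p - 1)

section pmean

variable {p l m a b : ℝ}

theorem pmean_nonneg (hl : 0 ≤ l) (hm : 0 ≤ m) (ha : 0 ≤ a) (hb : 0 ≤ b) :
    0 ≤ pmean p l m a b := by
  unfold pmean; positivity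

theorem pmean_rpow (hp : 1 < p) (hl : 0 ≤ l) (hm : 0 ≤ m) (ha : 0 ≤ a) (hb : 0 ≤ b) :
    pmean p l m a b ^ p = l * a ^ p + m * b ^ p := by
  rw [pmean, ← Real.rpow_mul (by positivity), one_div_mul_cancel (by linarith), Real.rpow_one]

theorem pmean_diag (hp : 1 < p) (hlm : l + m = 1) (ha : 0 ≤ a) : pmean p l m a a = a := by
  rw [pmean, ← add_mul, hlm, one_mul, ← Real.rpow_mul ha, mul_one_div_cancel (by linarith),
    Real.rpow_one]

theorem pmean_eq_zero_iff (hp : 1 < p) (hl : 0 < l) (hm : 0 < m) (ha : 0 ≤ a) (hb : 0 ≤ b) :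
    pmean p l m a b = 0 ↔ a = 0 ∧ b = 0 := by
  have hp0 : p ≠ 0 := by linarith
  rw [pmean, Real.rpow_eq_zero (by positivity) (by simpa using hp0),
    add_eq_zero_iff_of_nonneg (by positivity) (by positivity), mul_eq_zero, mul_eq_zero,
    Real.rpow_eq_zero ha hp0, Real.rpow_eq_zero hb hp0]
  simp [hl.ne', hm.ne']

theorem continuous_pmean (hp : 1 < p) : Continuous fun z : ℝ × ℝ => pmean p l m z.1 z.2 := by
  have hp0 : 0 ≤ p := by linarith
  unfold pmean
  refine Continuous.rpow_const ?_ fun _ => Or.inr (by positivity)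
  exact (continuous_const.mul (continuous_fst.rpow_const fun _ => Or.inr hp0)).add
    (continuous_const.mul (continuous_snd.rpow_const fun _ => Or.inr hp0))

theorem pmeanCoef_nonneg {M c : ℝ} (hl : 0 ≤ l) (hM : 0 ≤ M) (hc : 0 ≤ c) :
    0 ≤ pmeanCoef p l M c := by
  unfold pmeanCoef; split_ifs <;> positivity

/-- Jensen's inequality with the weights `l A ^ p` and `m B ^ p`, in the form of Hölder's
inequality. -/
theorem rpow_le_of_weights {A B x y : ℝ} (hp : 1 < p) (hl : 0 ≤ l) (hm : 0 ≤ m) (hA : 0 ≤ A)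
    (hB : 0 ≤ B) (hAB : l * A ^ p + m * B ^ p = 1) (hx : 0 ≤ x) (hy : 0 ≤ y) :
    (l * A ^ (p - 1) * x + m * B ^ (p - 1) * y) ^ p ≤ l * x ^ p + m * y ^ p := by
  have hp0 : p ≠ 0 := by linarith
  have hp1 : p - 1 ≠ 0 := by linarith
  have h1 : ∀ {A x : ℝ}, 0 ≤ A → A ^ (p - 1) * x = A ^ p * (x / A) := by
    intro A x hA
    rcases hA.eq_or_lt with rfl | hA
    · simp [Real.zero_rpow hp1]
    · rw [Real.rpow_sub_one hA.ne']; ring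
  have h2 : ∀ {A x : ℝ}, 0 ≤ A → 0 ≤ x → A ^ p * (x / A) ^ p ≤ x ^ p := by
    intro A x hA hx
    rcases hA.eq_or_lt with rfl | hA
    · rw [Real.zero_rpow hp0]; simp; positivity
    · rw [← Real.mul_rpow hA.le (by positivity), mul_div_cancel₀ _ hA.ne']
  have hconv := (convexOn_rpow hp.le).2 (mem_Ici.2 (div_nonneg hx hA))
    (mem_Ici.2 (div_nonneg hy hB)) (by positivity : 0 ≤ l * A ^ p)
    (by positivity : 0 ≤ m * B ^ p) hAB
  simp only [smul_eq_mul] at hconv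
  rw [mul_assoc, mul_assoc, h1 hA, h1 hB, ← mul_assoc, ← mul_assoc]
  refine hconv.trans ?_
  rw [mul_assoc, mul_assoc]
  gcongr
  · exact h2 hA hx
  · exact h2 hB hy

/-- The coefficients have the form required in `rpow_le_of_weights`, also at the origin. -/
theorem exists_pmeanCoef_eq (hp : 1 < p) (hl : 0 ≤ l) (hm : 0 ≤ m) (hlm : l + m = 1) (ha : 0 ≤ a)
    (hb : 0 ≤ b) : ∃ A B : ℝ, 0 ≤ A ∧ 0 ≤ B ∧ l * A ^ p + m * B ^ p = 1 ∧
      pmeanCoef p l (pmean p l m a b) a = l * A ^ (p - 1) ∧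
      pmeanCoef p m (pmean p l m a b) b = m * B ^ (p - 1) := by
  by_cases h : pmean p l m a b = 0
  · exact ⟨1, 1, by simp [pmeanCoef, h, hlm]⟩
  · have hM := pmean_nonneg (p := p) hl hm ha hb
    refine ⟨a / pmean p l m a b, b / pmean p l m a b, by positivity, by positivity, ?_,
      by simp [pmeanCoef, h], by simp [pmeanCoef, h]⟩
    rw [Real.div_rpow ha hM, Real.div_rpow hb hM, pmean_rpow hp hl hm ha hb]
    have : l * a ^ p + m * b ^ p ≠ 0 := by
      rw [← pmean_rpow hp hl hm ha hb]
      exact (Real.rpow_pos_of_pos (hM.lt_of_ne' h) p).ne'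
    field_simp

theorem pmeanCoef_rpow_le {x y : ℝ} (hp : 1 < p) (hl : 0 ≤ l) (hm : 0 ≤ m) (hlm : l + m = 1)
    (ha : 0 ≤ a) (hb : 0 ≤ b) (hx : 0 ≤ x) (hy : 0 ≤ y) :
    (pmeanCoef p l (pmean p l m a b) a * x + pmeanCoef p m (pmean p l m a b) b * y) ^ p
      ≤ l * x ^ p + m * y ^ p := by
  obtain ⟨A, B, hA, hB, hAB, h1, h2⟩ := exists_pmeanCoef_eq hp hl hm hlm ha hb
  rw [h1, h2]
  exact rpow_le_of_weights hp hl hm hA hB hAB hx hy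

theorem pmeanCoef_mul_add_le {x y : ℝ} (hp : 1 < p) (hl : 0 ≤ l) (hm : 0 ≤ m) (hlm : l + m = 1)
    (ha : 0 ≤ a) (hb : 0 ≤ b) (hx : 0 ≤ x) (hy : 0 ≤ y) :
    pmeanCoef p l (pmean p l m a b) a * x + pmeanCoef p m (pmean p l m a b) b * y
      ≤ pmean p l m x y := by
  have hM := pmean_nonneg (p := p) hl hm ha hb
  have h1 := pmeanCoef_nonneg (p := p) hl hM ha
  have h2 := pmeanCoef_nonneg (p := p) hm hM hb
  rw [← Real.rpow_le_rpow_iff (z := p) (by positivity) (pmean_nonneg hl hm hx hy) (by linarith),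
    pmean_rpow hp hl hm hx hy]
  exact pmeanCoef_rpow_le hp hl hm hlm ha hb hx hy

theorem pmeanCoef_add_le_one (hp : 1 < p) (hl : 0 ≤ l) (hm : 0 ≤ m) (hlm : l + m = 1)
    (ha : 0 ≤ a) (hb : 0 ≤ b) :
    pmeanCoef p l (pmean p l m a b) a + pmeanCoef p m (pmean p l m a b) b ≤ 1 := by
  have := pmeanCoef_mul_add_le hp hl hm hlm ha hb zero_le_one zero_le_one
  rwa [pmean_diag hp hlm zero_le_one, mul_one, mul_one] at this

/-- Euler's identity for the `1`-homogeneous power mean. -/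
theorem pmeanCoef_mul_add_eq (hp : 1 < p) (hl : 0 < l) (hm : 0 < m) (ha : 0 ≤ a) (hb : 0 ≤ b) :
    pmeanCoef p l (pmean p l m a b) a * a + pmeanCoef p m (pmean p l m a b) b * b
      = pmean p l m a b := by
  by_cases h : pmean p l m a b = 0
  · obtain ⟨rfl, rfl⟩ := (pmean_eq_zero_iff hp hl hm ha hb).1 h
    simp [h]
  · have hM : 0 < pmean p l m a b := (pmean_nonneg hl.le hm.le ha hb).lt_of_ne' h
    have hr := pmean_rpow hp hl.le hm.le ha hb
    have h1 : ∀ {x : ℝ}, 0 ≤ x → x ^ (p - 1) * x = x ^ p := by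
      intro x hx
      rcases hx.eq_or_lt with rfl | hx
      · simp [Real.zero_rpow (by linarith : p ≠ 0)]
      · rw [Real.rpow_sub_one hx.ne']; field_simp
    simp only [pmeanCoef, h, if_false, Real.div_rpow ha hM.le, Real.div_rpow hb hM.le]
    have hMp : 0 < pmean p l m a b ^ (p - 1) := by positivity
    calc _ = (l * (a ^ (p - 1) * a) + m * (b ^ (p - 1) * b)) / pmean p l m a b ^ (p - 1) := by
          field_simp
      _ = pmean p l m a b ^ p / pmean p l m a b ^ (p - 1) := by rw [h1 ha, h1 hb, hr]
      _ = pmean p l m a b := by rw [← h1 hM.le]; field_simp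

/-- The reverse triangle inequality for power means: the discrete hidden convexity. -/
theorem abs_pmean_sub_rpow_le (hp : 1 < p) (hl : 0 < l) (hm : 0 < m) (hlm : l + m = 1)
    {c d : ℝ} (ha : 0 ≤ a) (hb : 0 ≤ b) (hc : 0 ≤ c) (hd : 0 ≤ d) :
    |pmean p l m a b - pmean p l m c d| ^ p ≤ l * |a - c| ^ p + m * |b - d| ^ p := by
  wlog h : pmean p l m c d ≤ pmean p l m a b generalizing a b c d
  · rw [abs_sub_comm, abs_sub_comm a, abs_sub_comm b]
    exact this hc hd ha hb (le_of_not_ge h)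
  rw [abs_of_nonneg (sub_nonneg.2 h)]
  refine le_trans ?_
    (pmeanCoef_rpow_le hp hl.le hm.le hlm ha hb (abs_nonneg (a - c)) (abs_nonneg (b - d)))
  refine Real.rpow_le_rpow (sub_nonneg.2 h) ?_ (by linarith)
  have hM := pmean_nonneg (p := p) hl.le hm.le ha hb
  have h1 := pmeanCoef_nonneg (p := p) hl.le hM ha
  have h2 := pmeanCoef_nonneg (p := p) hm.le hM hb
  have h3 := pmeanCoef_mul_add_eq hp hl hm ha hb
  have h4 := pmeanCoef_mul_add_le hp hl.le hm.le hlm ha hb hc hd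
  have h5 := mul_le_mul_of_nonneg_left (le_abs_self (a - c)) h1
  have h6 := mul_le_mul_of_nonneg_left (le_abs_self (b - d)) h2
  linarith

theorem pmean_le_add (hp : 1 < p) (hl : 0 ≤ l) (hm : 0 ≤ m) (hlm : l + m = 1)
    (ha : 0 ≤ a) (hb : 0 ≤ b) : pmean p l m a b ≤ a + b := by
  rw [← Real.rpow_le_rpow_iff (z := p) (pmean_nonneg hl hm ha hb) (by positivity) (by linarith),
    pmean_rpow hp hl hm ha hb]
  have h1 : a ^ p ≤ (a + b) ^ p := Real.rpow_le_rpow ha (by linarith) (by linarith)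
  have h2 : b ^ p ≤ (a + b) ^ p := Real.rpow_le_rpow hb (by linarith) (by linarith)
  calc l * a ^ p + m * b ^ p ≤ l * (a + b) ^ p + m * (a + b) ^ p := by gcongr
    _ = (a + b) ^ p := by rw [← add_mul, hlm, one_mul]

/-- The shift `pmean (a + ε) (b + ε) - ε` is bounded independently of `ε`. -/
theorem abs_pmean_shift_le (hp : 1 < p) (hl : 0 < l) (hm : 0 < m) (hlm : l + m = 1)
    {ε : ℝ} (hε : 0 ≤ ε) (ha : 0 ≤ a) (hb : 0 ≤ b) :
    |pmean p l m (a + ε) (b + ε) - ε| ≤ a + b := by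
  have h := abs_pmean_sub_rpow_le hp hl hm hlm (add_nonneg ha hε) (add_nonneg hb hε) hε hε
  rw [pmean_diag hp hlm hε, add_sub_cancel_right, add_sub_cancel_right, abs_of_nonneg ha,
    abs_of_nonneg hb, ← pmean_rpow hp hl.le hm.le ha hb,
    Real.rpow_le_rpow_iff (abs_nonneg _) (pmean_nonneg hl.le hm.le ha hb) (by linarith)] at h
  exact h.trans (pmean_le_add hp hl.le hm.le hlm ha hb)

theorem tendsto_pmeanCoef {ι : Type*} {F : Filter ι} (hp : 1 < p) {M c : ι → ℝ} {M₀ c₀ : ℝ}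
    (hM₀ : M₀ ≠ 0) (hM : Tendsto M F (𝓝 M₀)) (hc : Tendsto c F (𝓝 c₀)) :
    Tendsto (fun i => pmeanCoef p l (M i) (c i)) F (𝓝 (pmeanCoef p l M₀ c₀)) := by
  have h1 : Tendsto (fun i => l * (c i / M i) ^ (p - 1)) F (𝓝 (pmeanCoef p l M₀ c₀)) := by
    rw [pmeanCoef, if_neg hM₀]
    exact ((hc.div hM hM₀).rpow_const (Or.inr (by linarith))).const_mul _
  refine h1.congr' ?_
  filter_upwards [hM.eventually_ne hM₀] with i hi
  rw [pmeanCoef, if_neg hi]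

theorem hasFDerivAt_pmean {N : ℕ} (hp : 1 < p) (hl : 0 < l) (hm : 0 < m) {U V : E N → ℝ}
    {U' V' : E N →L[ℝ] ℝ} {x : E N} (hU : HasFDerivAt U U' x) (hV : HasFDerivAt V V' x)
    (hUx : 0 < U x) (hVx : 0 < V x) :
    HasFDerivAt (fun y => pmean p l m (U y) (V y))
      (pmeanCoef p l (pmean p l m (U x) (V x)) (U x) • U' +
        pmeanCoef p m (pmean p l m (U x) (V x)) (V x) • V') x := by
  have hS : 0 < l * U x ^ p + m * V x ^ p := by positivity
  have hM : 0 < pmean p l m (U x) (V x) := by unfold pmean; positivity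
  have h1 := (((hU.rpow_const (p := p) (Or.inl hUx.ne')).const_mul l).add
    ((hV.rpow_const (p := p) (Or.inl hVx.ne')).const_mul m)).rpow_const (p := 1 / p)
      (Or.inl hS.ne')
  refine h1.congr_fderiv ?_
  have hMp : pmean p l m (U x) (V x) ^ (p - 1) = (l * U x ^ p + m * V x ^ p) ^ (1 - 1 / p) := by
    rw [pmean, ← Real.rpow_mul hS.le]
    congr 1
    field_simp
  have hpow : (l * U x ^ p + m * V x ^ p) ^ (1 / p - 1)
      = (pmean p l m (U x) (V x) ^ (p - 1))⁻¹ := by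
    rw [hMp, ← Real.rpow_neg hS.le]
    congr 1; ring
  ext e
  simp only [pmeanCoef, hM.ne', if_false, Real.div_rpow hUx.le hM.le, Real.div_rpow hVx.le hM.le,
    Pi.add_apply, hpow, add_apply, smul_apply, smul_eq_mul]
  field_simp

end pmean

/-! ### The chain rule for power means -/

/-- The coefficients of a power mean are nonnegative with sum at most `1`. -/
theorem norm_pmeanGrad_le {F : Type*} [NormedAddCommGroup F] [NormedSpace ℝ F] {p l m a b : ℝ}
    (hp : 1 < p) (hl : 0 ≤ l) (hm : 0 ≤ m) (hlm : l + m = 1) (ha : 0 ≤ a) (hb : 0 ≤ b) (ξ η : F) :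
    ‖pmeanCoef p l (pmean p l m a b) a • ξ + pmeanCoef p m (pmean p l m a b) b • η‖
      ≤ ‖ξ‖ + ‖η‖ := by
  have hM := pmean_nonneg (p := p) hl hm ha hb
  have h1 := pmeanCoef_nonneg (p := p) hl hM ha
  have h2 := pmeanCoef_nonneg (p := p) hm hM hb
  have h3 := pmeanCoef_add_le_one hp hl hm hlm ha hb
  refine (norm_add_le _ _).trans ?_
  rw [norm_smul, norm_smul, Real.norm_of_nonneg h1, Real.norm_of_nonneg h2]
  exact add_le_add (mul_le_of_le_one_left (norm_nonneg _) (by linarith))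
    (mul_le_of_le_one_left (norm_nonneg _) (by linarith))

theorem eLpNorm_le_of_norm_le_add {α F F₁ F₂ : Type*} [MeasurableSpace α] {μ : Measure α}
    [NormedAddCommGroup F] [NormedAddCommGroup F₁] [NormedAddCommGroup F₂] {q : ℝ≥0∞}
    (hq : 1 ≤ q) {f : α → F} {g : α → F₁} {h : α → F₂} (hg : AEStronglyMeasurable g μ)
    (hh : AEStronglyMeasurable h μ) (hle : ∀ᵐ x ∂μ, ‖f x‖ ≤ ‖g x‖ + ‖h x‖) :
    eLpNorm f q μ ≤ eLpNorm g q μ + eLpNorm h q μ := by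
  calc eLpNorm f q μ ≤ eLpNorm ((fun x => ‖g x‖) + fun x => ‖h x‖) q μ := by
        refine eLpNorm_mono_ae_real ?_
        simpa using hle
    _ ≤ eLpNorm (fun x => ‖g x‖) q μ + eLpNorm (fun x => ‖h x‖) q μ :=
        eLpNorm_add_le hg.norm hh.norm hq
    _ = _ := by rw [eLpNorm_norm, eLpNorm_norm]

/-- The power mean of two nonnegative Sobolev functions, shifted away from the singularity at the
origin, is a Sobolev function. -/
theorem IsWeakGradient.pmean_shift {N : ℕ} {p l m ε : ℝ} (hp : 1 < p) (hl : 0 < l) (hm : 0 < m)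
    (hlm : l + m = 1) (hε : 0 < ε) {u w : E N → ℝ} {G K : E N → E N} (hu : IsWeakGradient u G)
    (hw : IsWeakGradient w K) (hup : MemLp u (ENNReal.ofReal p) volume)
    (hwp : MemLp w (ENNReal.ofReal p) volume) (hGp : MemLp G (ENNReal.ofReal p) volume)
    (hKp : MemLp K (ENNReal.ofReal p) volume) (hu0 : ∀ᵐ x, 0 ≤ u x) (hw0 : ∀ᵐ x, 0 ≤ w x) :
    IsWeakGradient (fun x => pmean p l m (u x + ε) (w x + ε) - ε) fun x =>
      pmeanCoef p l (pmean p l m (u x + ε) (w x + ε)) (u x + ε) • G x +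
      pmeanCoef p m (pmean p l m (u x + ε) (w x + ε)) (w x + ε) • K x := by
  have hp1 : (1 : ℝ≥0∞) ≤ ENNReal.ofReal p := by simpa using hp.le
  set C : ℝ≥0∞ := (eLpNorm u (ENNReal.ofReal p) volume + eLpNorm w (ENNReal.ofReal p) volume) +
    (eLpNorm G (ENNReal.ofReal p) volume + eLpNorm K (ENNReal.ofReal p) volume)
  have hC : C ≠ ⊤ := ENNReal.add_ne_top.2 ⟨ENNReal.add_ne_top.2 ⟨hup.2.ne, hwp.2.ne⟩,
    ENNReal.add_ne_top.2 ⟨hGp.2.ne, hKp.2.ne⟩⟩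
  have hun : ∀ n x, 0 ≤ mollify n u x := fun n x => mollify_nonneg hu0 n x
  have hwn : ∀ n x, 0 ≤ mollify n w x := fun n x => mollify_nonneg hw0 n x
  have cu : ∀ n, ContDiff ℝ 1 (mollify n u) :=
    fun n => (contDiff_mollify hu.locallyIntegrable n).of_le (by simp)
  have cw : ∀ n, ContDiff ℝ 1 (mollify n w) :=
    fun n => (contDiff_mollify hw.locallyIntegrable n).of_le (by simp)
  refine (isWeakGradient_of_tendsto hp
    (v := fun n x => pmean p l m (mollify n u x + ε) (mollify n w x + ε) - ε)
    (g := fun n x =>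
      pmeanCoef p l (pmean p l m (mollify n u x + ε) (mollify n w x + ε)) (mollify n u x + ε) •
        mollify n G x +
      pmeanCoef p m (pmean p l m (mollify n u x + ε) (mollify n w x + ε)) (mollify n w x + ε) •
        mollify n K x) ?_ hC ?_ ?_ ?_ ?_).1
  · intro n
    refine isWeakGradient_of_contDiff ?_ ?_
    · have hU : ∀ x, mollify n u x + ε ≠ 0 := fun x => (add_pos_of_nonneg_of_pos (hun n x) hε).ne'
      have hW : ∀ x, mollify n w x + ε ≠ 0 := fun x => (add_pos_of_nonneg_of_pos (hwn n x) hε).ne'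
      unfold pmean
      refine ContDiff.sub (ContDiff.rpow_const_of_ne ?_ fun x => ?_) contDiff_const
      · exact (contDiff_const.mul (((cu n).add contDiff_const).rpow_const_of_ne hU)).add
          (contDiff_const.mul (((cw n).add contDiff_const).rpow_const_of_ne hW))
      · have h1 : 0 < mollify n u x + ε := by linarith [hun n x]
        have h2 : 0 < mollify n w x + ε := by linarith [hwn n x]
        positivity
    · intro x e
      have h1 := ((cu n).differentiable (by simp)).differentiableAt.hasFDerivAt (x := x)
      have h2 := ((cw n).differentiable (by simp)).differentiableAt.hasFDerivAt (x := x)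
      have h3 := (hasFDerivAt_pmean hp hl hm (h1.add_const ε) (h2.add_const ε)
        (by linarith [hun n x]) (by linarith [hwn n x])).sub_const ε
      rw [h3.fderiv]
      simp only [add_apply, smul_apply, smul_eq_mul,
        hu.fderiv_mollify, hw.fderiv_mollify, inner_add_left, inner_smul_left]
      simp
  · intro n
    refine (eLpNorm_le_of_norm_le_add hp1 (cu n).continuous.aestronglyMeasurable
      (cw n).continuous.aestronglyMeasurable (Eventually.of_forall fun x => ?_)).trans ?_
    · rw [Real.norm_of_nonneg (hun n x), Real.norm_of_nonneg (hwn n x)]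
      exact abs_pmean_shift_le hp hl hm hlm hε.le (hun n x) (hwn n x)
    · exact (add_le_add (eLpNorm_mollify_le hup.1 hp.le n)
        (eLpNorm_mollify_le hwp.1 hp.le n)).trans le_self_add
  · intro n
    refine (eLpNorm_le_of_norm_le_add hp1
      (contDiff_mollify hu.locallyIntegrable_grad n).continuous.aestronglyMeasurable
      (contDiff_mollify hw.locallyIntegrable_grad n).continuous.aestronglyMeasurable
      (Eventually.of_forall fun x => ?_)).trans ?_
    · exact norm_pmeanGrad_le hp hl.le hm.le hlm (by linarith [hun n x]) (by linarith [hwn n x]) _ _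
    · exact (add_le_add (eLpNorm_mollify_le hGp.1 hp.le n)
        (eLpNorm_mollify_le hKp.1 hp.le n)).trans le_add_self
  · filter_upwards [ae_tendsto_mollify hu.locallyIntegrable,
      ae_tendsto_mollify hw.locallyIntegrable] with x h1 h2
    exact (((continuous_pmean hp).tendsto (u x + ε, w x + ε)).comp
      ((h1.add_const ε).prodMk_nhds (h2.add_const ε))).sub_const ε
  · filter_upwards [ae_tendsto_mollify hu.locallyIntegrable,
      ae_tendsto_mollify hw.locallyIntegrable, ae_tendsto_mollify hu.locallyIntegrable_grad,
      ae_tendsto_mollify hw.locallyIntegrable_grad, hu0, hw0] with x h1 h2 h3 h4 h5 h6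
    have hM : pmean p l m (u x + ε) (w x + ε) ≠ 0 := by
      have h1 : 0 < u x + ε := by linarith
      have h2 : 0 < w x + ε := by linarith
      unfold pmean; positivity
    have hMt := ((continuous_pmean (l := l) (m := m) hp).tendsto (u x + ε, w x + ε)).comp
      ((h1.add_const ε).prodMk_nhds (h2.add_const ε))
    exact ((tendsto_pmeanCoef hp hM hMt (h1.add_const ε)).smul h3).add
      ((tendsto_pmeanCoef hp hM hMt (h2.add_const ε)).smul h4)

/-- The power mean of two nonnegative Sobolev functions is a Sobolev function. On the common zero
set the coefficients of the shifted means do not depend on the shift, so that no information on the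
gradients there is needed. -/
theorem IsWeakGradient.pmean {N : ℕ} {p l m : ℝ} (hp : 1 < p) (hl : 0 < l) (hm : 0 < m)
    (hlm : l + m = 1) {u w : E N → ℝ} {G K : E N → E N} (hu : IsWeakGradient u G)
    (hw : IsWeakGradient w K) (hup : MemLp u (ENNReal.ofReal p) volume)
    (hwp : MemLp w (ENNReal.ofReal p) volume) (hGp : MemLp G (ENNReal.ofReal p) volume)
    (hKp : MemLp K (ENNReal.ofReal p) volume) (hu0 : ∀ᵐ x, 0 ≤ u x) (hw0 : ∀ᵐ x, 0 ≤ w x) :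
    IsWeakGradient (fun x => pmean p l m (u x) (w x)) (fun x =>
        pmeanCoef p l (BrezisOswald.pmean p l m (u x) (w x)) (u x) • G x +
        pmeanCoef p m (BrezisOswald.pmean p l m (u x) (w x)) (w x) • K x) ∧
      MemLp (fun x => BrezisOswald.pmean p l m (u x) (w x)) (ENNReal.ofReal p) volume ∧
      MemLp (fun x => pmeanCoef p l (BrezisOswald.pmean p l m (u x) (w x)) (u x) • G x +
        pmeanCoef p m (BrezisOswald.pmean p l m (u x) (w x)) (w x) • K x)
        (ENNReal.ofReal p) volume := by
  have hp1 : (1 : ℝ≥0∞) ≤ ENNReal.ofReal p := by simpa using hp.le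
  set C : ℝ≥0∞ := (eLpNorm u (ENNReal.ofReal p) volume + eLpNorm w (ENNReal.ofReal p) volume) +
    (eLpNorm G (ENNReal.ofReal p) volume + eLpNorm K (ENNReal.ofReal p) volume)
  have hC : C ≠ ⊤ := ENNReal.add_ne_top.2 ⟨ENNReal.add_ne_top.2 ⟨hup.2.ne, hwp.2.ne⟩,
    ENNReal.add_ne_top.2 ⟨hGp.2.ne, hKp.2.ne⟩⟩
  have hε : ∀ n : ℕ, 0 < 1 / ((n : ℝ) + 1) := fun n => by positivity
  have hε0 : Tendsto (fun n : ℕ => 1 / ((n : ℝ) + 1)) atTop (𝓝 0) :=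
    tendsto_one_div_add_atTop_nhds_zero_nat
  refine isWeakGradient_of_tendsto hp
    (fun n => IsWeakGradient.pmean_shift hp hl hm hlm (hε n) hu hw hup hwp hGp hKp hu0 hw0)
    hC ?_ ?_ ?_ ?_
  · intro n
    refine (eLpNorm_le_of_norm_le_add hp1 hup.1 hwp.1 ?_).trans le_self_add
    filter_upwards [hu0, hw0] with x h1 h2
    rw [Real.norm_of_nonneg h1, Real.norm_of_nonneg h2]
    exact abs_pmean_shift_le hp hl hm hlm (hε n).le h1 h2
  · intro n
    refine (eLpNorm_le_of_norm_le_add hp1 hGp.1 hKp.1 ?_).trans le_add_self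
    filter_upwards [hu0, hw0] with x h1 h2
    exact norm_pmeanGrad_le hp hl.le hm.le hlm (add_nonneg h1 (hε n).le)
      (add_nonneg h2 (hε n).le) _ _
  · refine Eventually.of_forall fun x => ?_
    have h1 : Tendsto (fun n : ℕ => u x + 1 / ((n : ℝ) + 1)) atTop (𝓝 (u x)) := by
      simpa using hε0.const_add (u x)
    have h2 : Tendsto (fun n : ℕ => w x + 1 / ((n : ℝ) + 1)) atTop (𝓝 (w x)) := by
      simpa using hε0.const_add (w x)
    simpa using (((continuous_pmean (l := l) (m := m) hp).tendsto (u x, w x)).comp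
      (h1.prodMk_nhds h2)).sub hε0
  · filter_upwards [hu0, hw0] with x hx1 hx2
    have h1 : Tendsto (fun n : ℕ => u x + 1 / ((n : ℝ) + 1)) atTop (𝓝 (u x)) := by
      simpa using hε0.const_add (u x)
    have h2 : Tendsto (fun n : ℕ => w x + 1 / ((n : ℝ) + 1)) atTop (𝓝 (w x)) := by
      simpa using hε0.const_add (w x)
    by_cases hM : BrezisOswald.pmean p l m (u x) (w x) = 0
    · obtain ⟨hux, hwx⟩ := (pmean_eq_zero_iff hp hl hm hx1 hx2).1 hM
      refine tendsto_const_nhds.congr fun n => ?_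
      rw [hM, hux, hwx, zero_add, pmean_diag hp hlm (hε n).le]
      simp only [pmeanCoef, (hε n).ne', div_self (hε n).ne', if_false, if_true,
        Real.one_rpow, mul_one]
    · have hMt := ((continuous_pmean (l := l) (m := m) hp).tendsto (u x, w x)).comp
        (h1.prodMk_nhds h2)
      exact ((tendsto_pmeanCoef hp hM hMt h1).smul_const _).add
        ((tendsto_pmeanCoef hp hM hMt h2).smul_const _)

/-! ### Convexity of the energy -/

theorem rpow_sub_one_mul_self {p x : ℝ} (hp : 1 < p) (hx : 0 ≤ x) : x ^ (p - 1) * x = x ^ p := by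
  rcases hx.eq_or_lt with rfl | hx
  · simp [Real.zero_rpow (by linarith : p ≠ 0)]
  · rw [Real.rpow_sub_one hx.ne']; field_simp

/-- The tangent line inequality for `x ↦ x ^ p / p`. -/
theorem rpow_sub_one_mul_sub_le {p x y : ℝ} (hp : 1 < p) (hx : 0 ≤ x) (hy : 0 ≤ y) :
    x ^ (p - 1) * (y - x) ≤ 1 / p * (y ^ p - x ^ p) := by
  have hp0 : 0 < p := by linarith
  have hpq : p.HolderConjugate (p / (p - 1)) := Real.HolderConjugate.conjExponent hp
  have h := Real.young_inequality_of_nonneg hy (Real.rpow_nonneg hx (p - 1)) hpq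
  rw [← Real.rpow_mul hx, mul_div_cancel₀ _ (by linarith : p - 1 ≠ 0)] at h
  have h1 : x ^ p / (p / (p - 1)) = x ^ p - x ^ p / p := by field_simp
  rw [h1] at h
  rw [mul_sub, rpow_sub_one_mul_self hp hx]
  have h2 : 1 / p * (y ^ p - x ^ p) = y ^ p / p - x ^ p / p := by ring
  rw [h2]
  linarith

theorem rpow_sub_one_mul_le_add {p x y : ℝ} (hp : 1 < p) (hx : 0 ≤ x) (hy : 0 ≤ y) :
    x ^ (p - 1) * y ≤ x ^ p + y ^ p := by
  have h := rpow_sub_one_mul_sub_le hp hx hy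
  rw [mul_sub, rpow_sub_one_mul_self hp hx] at h
  have h1 : 1 / p ≤ 1 := by rw [div_le_one (by linarith)]; exact hp.le
  have h2 : 0 ≤ y ^ p := by positivity
  have h3 : 0 ≤ x ^ p := by positivity
  have h4 : 0 ≤ 1 / p := by positivity
  nlinarith

namespace IsFinslerMinkowskiNorm

variable {N : ℕ} {H : E N → ℝ}

theorem add_le (hH : IsFinslerMinkowskiNorm H) (ξ η : E N) : H (ξ + η) ≤ H ξ + H η := by
  have h := hH.convexOn.2 (mem_univ ((2 : ℝ) • ξ)) (mem_univ ((2 : ℝ) • η))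
    (by norm_num : (0 : ℝ) ≤ 1 / 2) (by norm_num : (0 : ℝ) ≤ 1 / 2) (by norm_num)
  simp only [smul_smul, hH.homogeneous, smul_eq_mul] at h
  norm_num at h
  linarith

theorem neg (hH : IsFinslerMinkowskiNorm H) (ξ : E N) : H (-ξ) = H ξ := by
  simpa using hH.homogeneous (-1) ξ

theorem continuous (hH : IsFinslerMinkowskiNorm H) : Continuous H := by
  obtain ⟨C₁, C₂, -, hC₂, hC⟩ := hH.comparable
  have h1 : ∀ ξ η, H ξ - H η ≤ C₂ * ‖ξ - η‖ := fun ξ η => by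
    have h := hH.add_le (ξ - η) η
    rw [sub_add_cancel] at h
    linarith [(hC (ξ - η)).2]
  refine (LipschitzWith.of_dist_le_mul (K := C₂.toNNReal) fun ξ η => ?_).continuous
  rw [Real.dist_eq, dist_eq_norm, Real.coe_toNNReal _ hC₂.le, abs_le]
  have := h1 ξ η
  have := h1 η ξ
  rw [norm_sub_rev] at this
  constructor <;> linarith

theorem inner_gradient_sub_le (hH : IsFinslerMinkowskiNorm H) {ξ : E N} (hξ : ξ ≠ 0) (η : E N) :
    inner ℝ (gradient H ξ) (η - ξ) ≤ H η - H ξ := by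
  have hd : HasFDerivAt H (fderiv ℝ H ξ) ξ :=
    ((hH.contDiffOn.contDiffAt (isOpen_compl_singleton.mem_nhds hξ)).differentiableAt
      (by simp)).hasFDerivAt
  have hl : HasDerivAt (fun t : ℝ => ξ + t • (η - ξ)) (η - ξ) 0 := by
    simpa using ((hasDerivAt_id (0 : ℝ)).smul_const (η - ξ)).const_add ξ
  have hd' : HasDerivAt (fun t : ℝ => H (ξ + t • (η - ξ))) (fderiv ℝ H ξ (η - ξ)) 0 := by
    refine HasFDerivAt.comp_hasDerivAt (l := H) (0 : ℝ) ?_ hl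
    simpa using hd
  have hgrad : inner ℝ (gradient H ξ) (η - ξ) = fderiv ℝ H ξ (η - ξ) := by
    rw [gradient, InnerProductSpace.toDual_symm_apply]
  rw [hgrad]
  refine le_of_tendsto hd'.tendsto_slope_zero_right ?_
  filter_upwards [Ioo_mem_nhdsGT (zero_lt_one' ℝ)] with t ht
  have hc := hH.convexOn.2 (mem_univ ξ) (mem_univ η) (by linarith [ht.2] : 0 ≤ 1 - t) ht.1.le
    (by ring)
  have he : (1 - t) • ξ + t • η = ξ + t • (η - ξ) := by
    rw [sub_smul, smul_sub, one_smul]; abel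
  rw [he] at hc
  simp only [smul_eq_mul, zero_add, zero_smul, add_zero] at hc ⊢
  rw [inv_mul_le_iff₀ ht.1]
  linarith

theorem abs_inner_gradient_le (hH : IsFinslerMinkowskiNorm H) {ξ : E N} (hξ : ξ ≠ 0) (η : E N) :
    |inner ℝ (gradient H ξ) η| ≤ H η := by
  have h1 := hH.inner_gradient_sub_le hξ (ξ + η)
  have h2 := hH.inner_gradient_sub_le hξ (ξ + -η)
  rw [add_sub_cancel_left] at h1 h2
  rw [inner_neg_right] at h2
  have h3 := hH.add_le ξ η
  have h4 := hH.add_le ξ (-η)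
  rw [hH.neg] at h4
  rw [abs_le]
  constructor <;> linarith

/-- Convexity of `H ^ p / p`. -/
theorem flux_inner_sub_le (hH : IsFinslerMinkowskiNorm H) {p : ℝ} (hp : 1 < p) (ξ η : E N) :
    H ξ ^ (p - 1) * inner ℝ (gradient H ξ) (η - ξ) ≤ 1 / p * (H η ^ p - H ξ ^ p) := by
  refine le_trans ?_ (rpow_sub_one_mul_sub_le hp (hH.nonneg ξ) (hH.nonneg η))
  by_cases hξ : ξ = 0
  · rw [(hH.eq_zero_iff ξ).2 hξ, Real.zero_rpow (by linarith)]; simp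
  · exact mul_le_mul_of_nonneg_left (hH.inner_gradient_sub_le hξ η)
      (Real.rpow_nonneg (hH.nonneg ξ) _)

theorem abs_flux_inner_le (hH : IsFinslerMinkowskiNorm H) {p : ℝ} (hp : 1 < p) (ξ η : E N) :
    |H ξ ^ (p - 1) * inner ℝ (gradient H ξ) η| ≤ H ξ ^ p + H η ^ p := by
  refine le_trans ?_ (rpow_sub_one_mul_le_add hp (hH.nonneg ξ) (hH.nonneg η))
  rw [abs_mul, abs_of_nonneg (Real.rpow_nonneg (hH.nonneg ξ) _)]
  by_cases hξ : ξ = 0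
  · rw [(hH.eq_zero_iff ξ).2 hξ, Real.zero_rpow (by linarith)]; simp
  · exact mul_le_mul_of_nonneg_left (hH.abs_inner_gradient_le hξ η)
      (Real.rpow_nonneg (hH.nonneg ξ) _)

theorem integrable_rpow (hH : IsFinslerMinkowskiNorm H) {p : ℝ} (hp : 0 < p) {μ : Measure (E N)}
    {G : E N → E N} (hG : MemLp G (ENNReal.ofReal p) μ) : Integrable (fun x => H (G x) ^ p) μ := by
  obtain ⟨C₁, C₂, -, hC₂, hC⟩ := hH.comparable
  have h := hG.integrable_norm_rpow (by simpa using hp) (by simp)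
  rw [ENNReal.toReal_ofReal hp.le] at h
  refine (h.const_mul (C₂ ^ p)).mono' ?_ (Eventually.of_forall fun x => ?_)
  · exact ((hH.continuous.comp_aestronglyMeasurable hG.1).aemeasurable.pow_const p
      ).aestronglyMeasurable
  · have := hH.nonneg (G x)
    rw [Real.norm_of_nonneg (by positivity), ← Real.mul_rpow hC₂.le (norm_nonneg _)]
    exact Real.rpow_le_rpow this (hC _).2 hp.le

theorem integrable_flux_inner (hH : IsFinslerMinkowskiNorm H) {p : ℝ} (hp : 1 < p)
    {μ : Measure (E N)} {G K : E N → E N} (hG : MemLp G (ENNReal.ofReal p) μ)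
    (hK : MemLp K (ENNReal.ofReal p) μ) :
    Integrable (fun x => H (G x) ^ (p - 1) * inner ℝ (gradient H (G x)) (K x)) μ := by
  -- The gradient is Borel measurable everywhere, including its junk value at the origin.
  have hgm : Measurable (gradient H) :=
    (LinearIsometryEquiv.continuous _).measurable.comp (measurable_fderiv ℝ H)
  refine ((hH.integrable_rpow (by linarith) hG).add (hH.integrable_rpow (by linarith) hK)).mono' ?_
    (Eventually.of_forall fun x => hH.abs_flux_inner_le hp _ _)
  have h1 : AEMeasurable (fun x => H (G x) ^ (p - 1)) μ :=
    (hH.continuous.comp_aestronglyMeasurable hG.1).aemeasurable.pow_const _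
  have h2 : AEMeasurable (fun x => gradient H (G x)) μ := hgm.comp_aemeasurable hG.1.aemeasurable
  exact h1.aestronglyMeasurable.mul (h2.aestronglyMeasurable.inner hK.1)

/-- Convexity of the local energy. -/
theorem integral_flux_inner_sub_le (hH : IsFinslerMinkowskiNorm H) {p : ℝ} (hp : 1 < p)
    {μ : Measure (E N)} {G K : E N → E N} (hG : MemLp G (ENNReal.ofReal p) μ)
    (hK : MemLp K (ENNReal.ofReal p) μ) :
    ∫ x, H (G x) ^ (p - 1) * inner ℝ (gradient H (G x)) (K x - G x) ∂μ
      ≤ 1 / p * (∫ x, H (K x) ^ p ∂μ - ∫ x, H (G x) ^ p ∂μ) := by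
  have hp0 : 0 < p := by linarith
  rw [← integral_sub (hH.integrable_rpow hp0 hK) (hH.integrable_rpow hp0 hG), ← integral_const_mul]
  refine integral_mono (hH.integrable_flux_inner hp hG (hK.sub hG))
    (((hH.integrable_rpow hp0 hK).sub (hH.integrable_rpow hp0 hG)).const_mul _) fun x => ?_
  exact hH.flux_inner_sub_le hp _ _

/-- Hidden convexity of the local energy density. -/
theorem pmeanGrad_rpow_le (hH : IsFinslerMinkowskiNorm H) {p l m a b : ℝ} (hp : 1 < p)
    (hl : 0 ≤ l) (hm : 0 ≤ m) (hlm : l + m = 1) (ha : 0 ≤ a) (hb : 0 ≤ b) (ξ η : E N) :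
    H (pmeanCoef p l (pmean p l m a b) a • ξ + pmeanCoef p m (pmean p l m a b) b • η) ^ p
      ≤ l * H ξ ^ p + m * H η ^ p := by
  have hM := pmean_nonneg (p := p) hl hm ha hb
  have h1 := pmeanCoef_nonneg (p := p) hl hM ha
  have h2 := pmeanCoef_nonneg (p := p) hm hM hb
  refine le_trans ?_ (pmeanCoef_rpow_le hp hl hm hlm ha hb (hH.nonneg ξ) (hH.nonneg η))
  refine Real.rpow_le_rpow (hH.nonneg _) ?_ (by linarith)
  refine (hH.add_le _ _).trans ?_
  rw [hH.homogeneous, hH.homogeneous, abs_of_nonneg h1, abs_of_nonneg h2]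

end IsFinslerMinkowskiNorm

theorem abs_rpow_sub_two_mul {p a : ℝ} (hp : 1 < p) : |(|a| ^ (p - 2) * a)| = |a| ^ (p - 1) := by
  rw [abs_mul, abs_of_nonneg (by positivity)]
  by_cases ha : a = 0
  · simp [ha, Real.zero_rpow (by linarith : p - 1 ≠ 0)]
  · rw [show p - 2 = (p - 1) - 1 by ring, Real.rpow_sub_one (abs_pos.2 ha).ne',
      div_mul_cancel₀ _ (abs_pos.2 ha).ne']

theorem abs_rpow_sub_two_mul_mul_sub_le {p : ℝ} (hp : 1 < p) (a b : ℝ) :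
    |a| ^ (p - 2) * a * (b - a) ≤ 1 / p * (|b| ^ p - |a| ^ p) := by
  refine le_trans ?_ (rpow_sub_one_mul_sub_le hp (abs_nonneg a) (abs_nonneg b))
  have h1 : |a| ^ (p - 2) * a * b ≤ |a| ^ (p - 1) * |b| := by
    rw [← abs_rpow_sub_two_mul hp, ← abs_mul]
    exact le_abs_self _
  have h2 : |a| ^ (p - 2) * a * a = |a| ^ (p - 1) * |a| := by
    have h3 : 0 ≤ |a| ^ (p - 2) * a * a := by
      rw [mul_assoc]
      exact mul_nonneg (by positivity) (mul_self_nonneg a)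
    rw [← abs_rpow_sub_two_mul hp, ← abs_mul, abs_of_nonneg h3]
  rw [mul_sub, mul_sub, h2]
  linarith

/-- The Gagliardo energy density of `u`. -/
noncomputable def gagliardo {N : ℕ} (p s : ℝ) (u : E N → ℝ) (z : E N × E N) : ℝ :=
  |u z.1 - u z.2| ^ p * ‖z.1 - z.2‖ ^ (-(N : ℝ) - p * s)

/-- Convexity of the nonlocal energy. -/
theorem nonlocalForm_sub_le {N : ℕ} {p s : ℝ} (hp : 1 < p) {u σ : E N → ℝ}
    (hum : AEStronglyMeasurable u volume) (hσm : AEStronglyMeasurable σ volume)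
    (hu : Integrable (gagliardo p s u) (volume.prod volume))
    (hσ : Integrable (gagliardo p s σ) (volume.prod volume))
    (hd : Integrable (gagliardo p s fun x => σ x - u x) (volume.prod volume)) :
    nonlocalForm p s u (fun x => σ x - u x)
      ≤ 1 / p * (∫ z, gagliardo p s σ z ∂(volume.prod volume)
          - ∫ z, gagliardo p s u z ∂(volume.prod volume)) := by
  have hdiff : ∀ {v : E N → ℝ}, AEStronglyMeasurable v volume →
      AEMeasurable (fun z : E N × E N => v z.1 - v z.2) (volume.prod volume) := fun {v} hv =>
    ((hv.comp_fst (ν := (volume : Measure (E N)))).sub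
      (hv.comp_snd (μ := (volume : Measure (E N))))).aemeasurable
  have hK : AEMeasurable (fun z : E N × E N => ‖z.1 - z.2‖ ^ (-(N : ℝ) - p * s))
      (volume.prod volume) := ((measurable_fst.sub measurable_snd).norm.pow_const _).aemeasurable
  rw [← integral_sub hσ hu, ← integral_const_mul, nonlocalForm]
  refine integral_mono ?_ ((hσ.sub hu).const_mul _) fun z => ?_
  · refine (hu.add hd).mono' (AEMeasurable.aestronglyMeasurable ?_)
      (Eventually.of_forall fun z => ?_)
    · exact ((((hdiff hum).abs.pow_const _).mul (hdiff hum)).mul (hdiff (hσm.sub hum))).mul hK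
    · have hk : 0 ≤ ‖z.1 - z.2‖ ^ (-(N : ℝ) - p * s) := by positivity
      rw [Real.norm_eq_abs, abs_mul, abs_of_nonneg hk, abs_mul, abs_rpow_sub_two_mul hp]
      simp only [Pi.add_apply, gagliardo, ← add_mul]
      exact mul_le_mul_of_nonneg_right
        (rpow_sub_one_mul_le_add hp (abs_nonneg _) (abs_nonneg _)) hk
  · have hk : 0 ≤ ‖z.1 - z.2‖ ^ (-(N : ℝ) - p * s) := by positivity
    have h := mul_le_mul_of_nonneg_right
      (abs_rpow_sub_two_mul_mul_sub_le hp (u z.1 - u z.2) (σ z.1 - σ z.2)) hk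
    have he : σ z.1 - u z.1 - (σ z.2 - u z.2) = σ z.1 - σ z.2 - (u z.1 - u z.2) := by ring
    simp only [gagliardo, he]
    refine h.trans (le_of_eq ?_)
    ring

/-! ### The energy inequality along power means -/

/-- The energy `∫_Ω H(G)^p + ∬ |u(x)-u(y)|^p |x-y|^{-N-ps}`, with `G` in the role of the weak
gradient of `u`. -/
noncomputable def energy {N : ℕ} (p s : ℝ) (Ω : Set (E N)) (H : E N → ℝ) (u : E N → ℝ)
    (G : E N → E N) : ℝ :=
  (∫ x in Ω, H (G x) ^ p) + ∫ z, gagliardo p s u z ∂(volume.prod volume)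

/-- The defect in the discrete hidden convexity inequality between `u` and `w`. -/
noncomputable def slack {N : ℕ} (p s l m : ℝ) (u w : E N → ℝ) (z : E N × E N) : ℝ :=
  l * gagliardo p s u z + m * gagliardo p s w z
    - gagliardo p s (fun x => pmean p l m (u x) (w x)) z

theorem slack_eq {N : ℕ} (p s l m : ℝ) (u w : E N → ℝ) (z : E N × E N) :
    slack p s l m u w z = (l * |u z.1 - u z.2| ^ p + m * |w z.1 - w z.2| ^ p
      - |pmean p l m (u z.1) (w z.1) - pmean p l m (u z.2) (w z.2)| ^ p)
        * ‖z.1 - z.2‖ ^ (-(N : ℝ) - p * s) := by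
  simp only [slack, gagliardo]; ring

theorem slack_nonneg {N : ℕ} {p s l m : ℝ} (hp : 1 < p) (hl : 0 < l) (hm : 0 < m)
    (hlm : l + m = 1) {u w : E N → ℝ} (hu0 : ∀ᵐ x, 0 ≤ u x) (hw0 : ∀ᵐ x, 0 ≤ w x) :
    ∀ᵐ z ∂((volume : Measure (E N)).prod volume), 0 ≤ slack p s l m u w z := by
  have h1 : ∀ᵐ x, 0 ≤ u x ∧ 0 ≤ w x := hu0.and hw0
  have h2 := Measure.quasiMeasurePreserving_fst (μ := (volume : Measure (E N)))
    (ν := (volume : Measure (E N))) |>.ae h1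
  have h3 := Measure.quasiMeasurePreserving_snd (μ := (volume : Measure (E N)))
    (ν := (volume : Measure (E N))) |>.ae h1
  filter_upwards [h2, h3] with z hz1 hz2
  rw [slack_eq]
  exact mul_nonneg (sub_nonneg.2 (abs_pmean_sub_rpow_le hp hl hm hlm hz1.1 hz1.2 hz2.1 hz2.2))
    (by positivity)

/-- The central inequality: convexity of the energy along `u` and the power mean `σ` of `u` and `w`,
tested with the equation for `u`, combined with hidden convexity. -/
theorem IsWeakSolution.integral_le_energy_sub_slack {N : ℕ} (hN : 1 ≤ N) {p s l m : ℝ}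
    (hp : 1 < p) (hs₀ : 0 < s) (hs₁ : s < 1) (hl : 0 < l) (hm : 0 < m) (hlm : l + m = 1)
    {Ω : Set (E N)} {H : E N → ℝ} (hH : IsFinslerMinkowskiNorm H)
    {f : E N → ℝ → ℝ} {u w : E N → ℝ} {G K : E N → E N} (hu : IsWeakSolution p s Ω H f u)
    (hw : MemW0 p Ω w) (hG : IsWeakGradient u G) (hGp : MemLp G (ENNReal.ofReal p) volume)
    (hK : IsWeakGradient w K) (hKp : MemLp K (ENNReal.ofReal p) volume)
    (hu0 : ∀ᵐ x, 0 ≤ u x) (hw0 : ∀ᵐ x, 0 ≤ w x) :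
    Integrable (slack p s l m u w) (volume.prod volume) ∧
    ∫ x in Ω, f x (u x) * (pmean p l m (u x) (w x) - u x) ≤
      1 / p * (m * (energy p s Ω H w K - energy p s Ω H u G)
        - ∫ z, slack p s l m u w z ∂(volume.prod volume)) := by
  have hp0 : 0 < p := by linarith
  obtain ⟨hS, hσp, hSp⟩ := IsWeakGradient.pmean hp hl hm hlm hG hK hu.mem.memLp hw.memLp
    hGp hKp hu0 hw0
  set σ : E N → ℝ := fun x => pmean p l m (u x) (w x) with hσ
  set S : E N → E N := fun x =>
        pmeanCoef p l (BrezisOswald.pmean p l m (u x) (w x)) (u x) • G x +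
        pmeanCoef p m (BrezisOswald.pmean p l m (u x) (w x)) (w x) • K x
  have hφ : MemW0 p Ω fun x => σ x - u x := by
    refine ⟨hσp.sub hu.mem.memLp, ⟨_, hS.sub hG, hSp.sub hGp⟩, ?_⟩
    filter_upwards [hu.mem.eq_zero, hw.eq_zero] with x h1 h2 hx
    simp only [hσ, h1 hx, h2 hx]
    rw [(pmean_eq_zero_iff hp hl hm le_rfl le_rfl).2 ⟨rfl, rfl⟩, sub_zero]
  have gu : Integrable (gagliardo p s u) (volume.prod volume) :=
    hG.integrable_gagliardo hN hp hs₀ hs₁ hu.mem.memLp hGp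
  have gw : Integrable (gagliardo p s w) (volume.prod volume) :=
    hK.integrable_gagliardo hN hp hs₀ hs₁ hw.memLp hKp
  have gσ : Integrable (gagliardo p s σ) (volume.prod volume) :=
    hS.integrable_gagliardo hN hp hs₀ hs₁ hσp hSp
  have gd : Integrable (gagliardo p s fun x => σ x - u x) (volume.prod volume) :=
    (hS.sub hG).integrable_gagliardo hN hp hs₀ hs₁ hφ.memLp (hSp.sub hGp)
  have hslack : Integrable (slack p s l m u w) (volume.prod volume) :=
    ((gu.const_mul l).add (gw.const_mul m)).sub gσ
  refine ⟨hslack, ?_⟩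
  have hweak := hu.weak_eq _ hφ G _ hG (hS.sub hG)
  have h1 : localForm p Ω H G (fun x => S x - G x)
      ≤ 1 / p * ((∫ x in Ω, H (S x) ^ p) - ∫ x in Ω, H (G x) ^ p) :=
    hH.integral_flux_inner_sub_le hp (hGp.restrict Ω) (hSp.restrict Ω)
  have h2 := nonlocalForm_sub_le hp hu.mem.memLp.1 hσp.1 gu gσ gd
  have iG := hH.integrable_rpow hp0 (hGp.restrict Ω)
  have iK := hH.integrable_rpow hp0 (hKp.restrict Ω)
  have h3 : ∫ x in Ω, H (S x) ^ p ≤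
      l * (∫ x in Ω, H (G x) ^ p) + m * ∫ x in Ω, H (K x) ^ p := by
    rw [← integral_const_mul, ← integral_const_mul,
      ← integral_add (iG.const_mul l) (iK.const_mul m)]
    refine integral_mono_ae (hH.integrable_rpow hp0 (hSp.restrict Ω))
      ((iG.const_mul l).add (iK.const_mul m)) (ae_restrict_of_ae ?_)
    filter_upwards [hu0, hw0] with x hx1 hx2
    exact hH.pmeanGrad_rpow_le hp hl.le hm.le hlm hx1 hx2 _ _
  have h4 : ∫ z, slack p s l m u w z ∂(volume.prod volume) =
      l * (∫ z, gagliardo p s u z ∂(volume.prod volume))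
        + m * (∫ z, gagliardo p s w z ∂(volume.prod volume))
        - ∫ z, gagliardo p s σ z ∂(volume.prod volume) := by
    rw [← integral_const_mul, ← integral_const_mul,
      ← integral_add (gu.const_mul l) (gw.const_mul m)]
    exact integral_sub ((gu.const_mul l).add (gw.const_mul m)) gσ
  rw [← hweak]
  refine (add_le_add h1 h2).trans ?_
  rw [← mul_add]
  refine mul_le_mul_of_nonneg_left ?_ (by positivity)
  obtain rfl : l = 1 - m := by linarith
  simp only [energy]
  linarith

/-! ### Superposition operators -/

/-- Carathéodory functions preserve measurability under superposition. -/
theorem aemeasurable_superposition {α : Type*} [MeasurableSpace α] {μ : Measure α}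
    {f : α → ℝ → ℝ} (hf : ∀ t : ℝ, 0 ≤ t → AEMeasurable (fun x => f x t) μ)
    (hc : ∀ᵐ x ∂μ, ContinuousOn (f x) (Ici 0)) {u : α → ℝ} (hu : AEMeasurable u μ)
    (hu0 : ∀ᵐ x ∂μ, 0 ≤ u x) : AEMeasurable (fun x => f x (u x)) μ := by
  wlog hum : Measurable u generalizing u
  · have h := this (u := hu.mk u) hu.measurable_mk.aemeasurable
      (by filter_upwards [hu0, hu.ae_eq_mk] with x h1 h2; rwa [← h2]) hu.measurable_mk
    refine h.congr ?_
    filter_upwards [hu.ae_eq_mk] with x hx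
    rw [← hx]
  have hlim : ∀ᵐ x ∂μ, Tendsto (fun n : ℕ => f x (⌊u x * (n : ℝ)⌋₊ / (n : ℝ))) atTop
      (𝓝 (f x (u x))) := by
    filter_upwards [hc, hu0] with x h1 h2
    have h3 : Tendsto (fun n : ℕ => (⌊u x * (n : ℝ)⌋₊ / (n : ℝ) : ℝ)) atTop (𝓝 (u x)) :=
      (tendsto_nat_floor_mul_div_atTop h2).comp tendsto_natCast_atTop_atTop
    exact (h1 _ h2).tendsto.comp (tendsto_nhdsWithin_iff.2 ⟨h3, Eventually.of_forall fun n => by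
      simp only [mem_Ici]; positivity⟩)
  refine aemeasurable_of_tendsto_metrizable_ae atTop (fun n => ?_) hlim
  have hfl : Measurable fun x => ⌊u x * (n : ℝ)⌋₊ := Nat.measurable_floor.comp (hum.mul_const _)
  have huniv : (⋃ k : ℕ, (fun x => ⌊u x * (n : ℝ)⌋₊) ⁻¹' {k}) = univ := by
    ext x; simp
  rw [← Measure.restrict_univ (μ := μ), ← huniv, aemeasurable_iUnion_iff]
  intro k
  refine ((hf (k / n) (by positivity)).restrict).congr ?_
  filter_upwards [ae_restrict_mem (hfl (measurableSet_singleton k))] with x hx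
  have : ⌊u x * (n : ℝ)⌋₊ = k := hx
  rw [this]

/-- The growth condition makes `f(·,u)` act on `L^p`. -/
theorem IsAdmissible.integrable_mul {N : ℕ} {p : ℝ} (hp : 1 < p) {Ω : Set (E N)}
    (hΩ : volume Ω ≠ ⊤) {f : E N → ℝ → ℝ} (hf : IsAdmissible p Ω f) {u φ : E N → ℝ}
    (hu : MemLp u (ENNReal.ofReal p) volume) (hφ : MemLp φ (ENNReal.ofReal p) volume)
    (hu0 : ∀ᵐ x, 0 ≤ u x) : Integrable (fun x => f x (u x) * φ x) (volume.restrict Ω) := by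
  have hp0 : 0 < p := by linarith
  have hp1 : (1 : ℝ≥0∞) ≤ ENNReal.ofReal p := by simpa using hp.le
  have : IsFiniteMeasure (volume.restrict Ω) := isFiniteMeasure_restrict.2 hΩ
  obtain ⟨c, hc, hgrowth⟩ := hf.growth
  have iu := (hu.restrict Ω).integrable_norm_rpow (by simpa using hp0) (by simp)
  have iφ := (hφ.restrict Ω).integrable_norm_rpow (by simpa using hp0) (by simp)
  rw [ENNReal.toReal_ofReal hp0.le] at iu iφ
  have hm := aemeasurable_superposition hf.measurable hf.continuous
    (hu.1.aemeasurable.restrict) (ae_restrict_of_ae hu0)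
  refine ((((hφ.restrict Ω).integrable hp1).norm.add (iu.add iφ)).const_mul c).mono'
    (hm.mul (hφ.1.aemeasurable.restrict)).aestronglyMeasurable ?_
  filter_upwards [hgrowth, ae_restrict_of_ae hu0] with x h1 h2
  rw [norm_mul, Real.norm_eq_abs]
  simp only [Pi.add_apply]
  rw [Real.norm_of_nonneg h2]
  have h3 := rpow_sub_one_mul_le_add hp h2 (norm_nonneg (φ x))
  calc |f x (u x)| * ‖φ x‖ ≤ c * (1 + u x ^ (p - 1)) * ‖φ x‖ := by
        gcongr; exact h1 _ h2
    _ = c * (‖φ x‖ + u x ^ (p - 1) * ‖φ x‖) := by ring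
    _ ≤ _ := by gcongr

/-! ### Difference quotients along power means -/

section quotients

variable {p a b : ℝ}

theorem arith_le_pmean (hp : 1 < p) {t : ℝ} (ht0 : 0 < t) (ht1 : t < 1) (ha : 0 ≤ a)
    (hb : 0 ≤ b) : (1 - t) * a + t * b ≤ pmean p (1 - t) t a b := by
  have h1 : 0 ≤ 1 - t := by linarith
  rw [← Real.rpow_le_rpow_iff (z := p) (by positivity) (pmean_nonneg h1 ht0.le ha hb)
    (by linarith), pmean_rpow hp h1 ht0.le ha hb]
  exact (convexOn_rpow hp.le).2 (mem_Ici.2 ha) (mem_Ici.2 hb) h1 ht0.le (by ring)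

theorem rpow_mul_pmean_sub_le (hp : 1 < p) {t : ℝ} (ht0 : 0 < t) (ht1 : t < 1) (ha : 0 ≤ a)
    (hb : 0 ≤ b) : a ^ (p - 1) * (pmean p (1 - t) t a b - a) ≤ t * b ^ p := by
  have h1 : 0 ≤ 1 - t := by linarith
  refine (rpow_sub_one_mul_sub_le hp ha (pmean_nonneg h1 ht0.le ha hb)).trans ?_
  rw [pmean_rpow hp h1 ht0.le ha hb]
  have h2 : 1 / p ≤ 1 := by rw [div_le_one (by linarith)]; exact hp.le
  have h3 : 0 ≤ t * b ^ p := by positivity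
  have h4 : 0 ≤ t * a ^ p := by positivity
  have h5 : 0 ≤ 1 / p := by positivity
  nlinarith

/-- A minorant, uniform in `t`, of the difference quotients. Where the nonlinearity `y` is
nonnegative, the power mean is compared with the arithmetic mean; where it is negative, `a ≥ ρ` is
bounded away from zero. -/
theorem le_mul_pmean_sub_div (hp : 1 < p) {t : ℝ} (ht0 : 0 < t) (ht1 : t < 1) (ha : 0 ≤ a)
    (hb : 0 ≤ b) {y c ρ : ℝ} (hc : 0 < c) (hρ : 0 < ρ) (hy : |y| ≤ c * (1 + a ^ (p - 1)))
    (hpos : a < ρ → 0 ≤ y) :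
    -(|y * (b - a)| + c * (1 / ρ ^ (p - 1) + 1) * b ^ p)
      ≤ y * (pmean p (1 - t) t a b - a) / t := by
  have hρp : 0 < ρ ^ (p - 1) := by positivity
  have hC : 0 ≤ c * (1 / ρ ^ (p - 1) + 1) * b ^ p := by positivity
  rw [le_div_iff₀ ht0]
  rcases le_or_gt 0 y with h | h
  · have h1 := arith_le_pmean hp ht0 ht1 ha hb
    have h2 : y * (t * (b - a)) ≤ y * (pmean p (1 - t) t a b - a) := by gcongr; linarith
    have h3 := mul_le_mul_of_nonneg_right (neg_abs_le (y * (b - a))) ht0.le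
    nlinarith
  · have ha' : ρ ≤ a := by
      by_contra hlt
      exact absurd (hpos (lt_of_not_ge hlt)) (not_le.2 h)
    have hap : ρ ^ (p - 1) ≤ a ^ (p - 1) := Real.rpow_le_rpow hρ.le ha' (by linarith)
    have h1 : 1 ≤ 1 / ρ ^ (p - 1) * a ^ (p - 1) := by
      rw [one_div, inv_mul_eq_div, le_div_iff₀ hρp]; linarith
    have hy' : -y ≤ c * (1 / ρ ^ (p - 1) + 1) * a ^ (p - 1) := by
      rw [← abs_of_neg h]
      refine hy.trans ?_
      rw [mul_assoc, add_mul, one_mul]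
      gcongr
    have habs : 0 ≤ |y * (b - a)| * t := by positivity
    rcases le_total (pmean p (1 - t) t a b) a with hσ | hσ
    · have : 0 ≤ y * (pmean p (1 - t) t a b - a) :=
        mul_nonneg_of_nonpos_of_nonpos h.le (by linarith)
      nlinarith [mul_nonneg hC ht0.le]
    · have h2 := mul_le_mul_of_nonneg_right hy' (sub_nonneg.2 hσ)
      have h3 := mul_le_mul_of_nonneg_left (rpow_mul_pmean_sub_le hp ht0 ht1 ha hb)
        (by positivity : 0 ≤ c * (1 / ρ ^ (p - 1) + 1))
      nlinarith

theorem hasDerivAt_pmean (hp : 1 < p) (ha : 0 < a) :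
    HasDerivAt (fun t => pmean p (1 - t) t a b) ((b ^ p - a ^ p) / (p * a ^ (p - 1))) 0 := by
  have hap : 0 < a ^ p := by positivity
  have h1 : HasDerivAt (fun t : ℝ => (1 - t) * a ^ p + t * b ^ p) (b ^ p - a ^ p) 0 := by
    have := (((hasDerivAt_id (0 : ℝ)).const_sub 1).mul_const (a ^ p)).add
      ((hasDerivAt_id (0 : ℝ)).mul_const (b ^ p))
    refine this.congr_deriv ?_
    ring
  have h2 := h1.rpow_const (p := 1 / p) (Or.inl (by simpa using hap.ne'))
  refine h2.congr_deriv ?_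
  have h3 : (a ^ p) ^ (1 / p - 1) = (a ^ (p - 1))⁻¹ := by
    rw [← Real.rpow_mul ha.le, ← Real.rpow_neg ha.le]
    congr 1
    field_simp
    ring
  simp only [sub_zero, one_mul, zero_mul, add_zero, h3]
  field_simp

theorem tendsto_pmean_sub_div (hp : 1 < p) (ha : 0 < a) :
    Tendsto (fun t => (pmean p (1 - t) t a b - a) / t) (𝓝[>] 0)
      (𝓝 ((b ^ p - a ^ p) / (p * a ^ (p - 1)))) := by
  have h := (hasDerivAt_pmean (b := b) hp ha).tendsto_slope_zero_right
  refine h.congr fun t => ?_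
  have h0 : pmean p (1 - 0) 0 a b = a := by
    simp [pmean, ← Real.rpow_mul ha.le, mul_inv_cancel₀ (by linarith : p ≠ 0)]
  simp only [zero_add, h0, smul_eq_mul]
  ring

/-- Along `t = τ ^ p` the slack between a zero of `u` and a point where `u` is positive is of first
order in `τ`, hence of larger order than `t`. -/
theorem tendsto_slack_div (hp : 1 < p) (ha : 0 < a) (hb : 0 < b) (d : ℝ) :
    Tendsto (fun τ : ℝ => ((1 - τ ^ p) * |0 - a| ^ p + τ ^ p * |b - d| ^ p
      - |pmean p (1 - τ ^ p) (τ ^ p) 0 b - pmean p (1 - τ ^ p) (τ ^ p) a d| ^ p) / τ) (𝓝[>] 0)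
      (𝓝 (p * a ^ (p - 1) * b)) := by
  have hp0 : p ≠ 0 := by linarith
  have hτ : HasDerivAt (fun τ : ℝ => τ ^ p) 0 0 := by
    have := Real.hasDerivAt_rpow_const (x := 0) (p := p) (Or.inr hp.le)
    rwa [Real.zero_rpow (by linarith), mul_zero] at this
  have hP : HasDerivAt (fun τ : ℝ => pmean p (1 - τ ^ p) (τ ^ p) a d) 0 0 := by
    have h := hasDerivAt_pmean (b := d) hp ha
    have h' : HasDerivAt (fun t => pmean p (1 - t) t a d) ((d ^ p - a ^ p) / (p * a ^ (p - 1)))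
        ((0 : ℝ) ^ p) := by rwa [Real.zero_rpow hp0]
    simpa [Function.comp_def] using h'.comp (0 : ℝ) hτ
  have hP0 : pmean p (1 - (0 : ℝ) ^ p) ((0 : ℝ) ^ p) a d = a := by
    simp [Real.zero_rpow hp0, pmean, ← Real.rpow_mul ha.le, mul_inv_cancel₀ hp0]
  have hQ : HasDerivAt (fun τ : ℝ => pmean p (1 - τ ^ p) (τ ^ p) a d - τ * b) (-b) 0 := by
    refine (hP.sub ((hasDerivAt_id (0 : ℝ)).mul_const b)).congr_deriv ?_
    ring
  have hQp := hQ.rpow_const (p := p) (Or.inr hp.le)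
  have hF := (((hτ.const_sub 1).mul_const (|0 - a| ^ p)).add (hτ.mul_const (|b - d| ^ p))).sub hQp
  have hlim := hF.tendsto_slope_zero_right
  have hval : -0 * |0 - a| ^ p + 0 * |b - d| ^ p - -b * p *
      (pmean p (1 - (0 : ℝ) ^ p) ((0 : ℝ) ^ p) a d - 0 * b) ^ (p - 1) = p * a ^ (p - 1) * b := by
    rw [hP0]; ring_nf
  rw [hval] at hlim
  refine hlim.congr' ?_
  have hcont : ∀ᶠ τ in 𝓝[>] (0 : ℝ), 0 < pmean p (1 - τ ^ p) (τ ^ p) a d - τ * b := by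
    refine (hQ.continuousAt.tendsto.mono_left nhdsWithin_le_nhds).eventually (lt_mem_nhds ?_)
    rw [hP0]; simpa using ha
  filter_upwards [hcont, self_mem_nhdsWithin] with τ h1 h2
  have h2' : 0 < τ := h2
  have h3 : pmean p (1 - τ ^ p) (τ ^ p) 0 b = τ * b := by
    rw [pmean, Real.zero_rpow hp0, mul_zero, zero_add, ← Real.mul_rpow h2'.le hb.le,
      ← Real.rpow_mul (by positivity), mul_one_div_cancel hp0, Real.rpow_one]
  have h4 : |0 - a| ^ p = a ^ p := by rw [zero_sub, abs_neg, abs_of_pos ha]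
  rw [h3, abs_sub_comm (τ * b), abs_of_pos h1]
  rw [Real.zero_rpow hp0, sub_zero] at hP0
  simp only [zero_add, Pi.add_apply, Pi.sub_apply, Real.zero_rpow hp0, smul_eq_mul, h4, zero_mul,
    hP0, sub_zero, one_mul, add_zero]
  ring

end quotients

/-! ### Comparison of two weak solutions -/

theorem IsWeakSolution.ae_nonneg {N : ℕ} {p s : ℝ} {Ω : Set (E N)} (hΩ : MeasurableSet Ω)
    {H : E N → ℝ} {f : E N → ℝ → ℝ} {u : E N → ℝ} (hu : IsWeakSolution p s Ω H f u) :
    ∀ᵐ x, 0 ≤ u x := by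
  filter_upwards [(ae_restrict_iff' hΩ).1 hu.nonneg, hu.mem.eq_zero] with x h1 h2
  by_cases hx : x ∈ Ω
  · exact h1 hx
  · exact (h2 hx).ge

/-- The parameters `τ` along which the limits `τ → 0` are taken. -/
noncomputable def stepSize (n : ℕ) : ℝ := 1 / ((n : ℝ) + 2)

theorem stepSize_pos (n : ℕ) : 0 < stepSize n := by unfold stepSize; positivity

theorem stepSize_lt_one (n : ℕ) : stepSize n < 1 := by
  unfold stepSize
  rw [div_lt_one (by positivity)]
  have : (0 : ℝ) ≤ n := by positivity
  linarith

theorem tendsto_stepSize : Tendsto stepSize atTop (𝓝[>] 0) := by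
  refine tendsto_nhdsWithin_iff.2 ⟨?_, Eventually.of_forall stepSize_pos⟩
  have h := (tendsto_one_div_add_atTop_nhds_zero_nat (𝕜 := ℝ)).comp (tendsto_add_atTop_nat 1)
  refine h.congr fun n => ?_
  simp only [Function.comp_apply, stepSize]
  push_cast
  ring

/-- The difference diffQuotient, along power means of `u` and `w`, of the right-hand side of the
equation for `u`. -/
noncomputable def diffQuotient {N : ℕ} (p t : ℝ) (f : E N → ℝ → ℝ) (u w : E N → ℝ) (x : E N) : ℝ :=
  f x (u x) * (pmean p (1 - t) t (u x) (w x) - u x) / t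

/-- An integrable minorant, uniform in `t`, of the difference quotients of the right-hand side. It
makes Fatou's lemma available although `(w ^ p - u ^ p) / u ^ (p - 1)` need not be
integrable. -/
theorem IsAdmissible.exists_minorant {N : ℕ} {p : ℝ} (hp : 1 < p) {Ω : Set (E N)}
    (hΩ : volume Ω ≠ ⊤) {f : E N → ℝ → ℝ} (hf : IsAdmissible p Ω f)
    {u w : E N → ℝ} (hup : MemLp u (ENNReal.ofReal p) volume)
    (hwp : MemLp w (ENNReal.ofReal p) volume) (hu0 : ∀ᵐ x, 0 ≤ u x) (hw0 : ∀ᵐ x, 0 ≤ w x) :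
    ∃ L : E N → ℝ, Integrable L (volume.restrict Ω) ∧ ∀ t : ℝ, 0 < t → t < 1 →
      ∀ᵐ x ∂(volume.restrict Ω), L x ≤ diffQuotient p t f u w x := by
  have hp0 : 0 < p := by linarith
  obtain ⟨c, hc, hgrowth⟩ := hf.growth
  obtain ⟨ρ, hρ, hpos⟩ := hf.pos
  refine ⟨fun x => -(|f x (u x) * (w x - u x)| + c * (1 / ρ ^ (p - 1) + 1) * ‖w x‖ ^ p), ?_, ?_⟩
  · have iw := (hwp.restrict Ω).integrable_norm_rpow (by simpa using hp0) (by simp)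
    rw [ENNReal.toReal_ofReal hp0.le] at iw
    exact ((hf.integrable_mul hp hΩ hup (hwp.sub hup) hu0).abs.add (iw.const_mul _)).neg
  · intro t ht0 ht1
    filter_upwards [hgrowth, hpos, hf.continuous, ae_restrict_of_ae hu0, ae_restrict_of_ae hw0]
      with x h1 h2 h3 h4 h5
    -- Positivity for small `t > 0` only gives a sign at `t = 0` through continuity.
    have hf0 : 0 ≤ f x 0 := by
      have hcw : Tendsto (f x) (𝓝[>] 0) (𝓝 (f x 0)) :=
        ((h3 0 (mem_Ici.2 le_rfl)).mono Ioi_subset_Ici_self).tendsto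
      refine ge_of_tendsto hcw ?_
      filter_upwards [Ioo_mem_nhdsGT hρ] with t ht
      exact (h2 t ht.1 ht.2).le
    have hy : u x < ρ → 0 ≤ f x (u x) := fun hlt => by
      rcases h4.eq_or_lt with h0 | h0
      · rw [← h0]; exact hf0
      · exact (h2 _ h0 hlt).le
    rw [Real.norm_of_nonneg h5]
    exact le_mul_pmean_sub_div hp ht0 ht1 h4 h5 hc hρ (h1 _ h4) hy

/-- The energy inequality along power means, divided by `t`. -/
theorem IsWeakSolution.integral_diffQuotient_add_le {N : ℕ} (hN : 1 ≤ N) {p s t : ℝ}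
    (hp : 1 < p) (hs₀ : 0 < s) (hs₁ : s < 1) (ht0 : 0 < t) (ht1 : t < 1)
    {Ω : Set (E N)} {H : E N → ℝ} (hH : IsFinslerMinkowskiNorm H)
    {f : E N → ℝ → ℝ} {u w : E N → ℝ} {G K : E N → E N} (hu : IsWeakSolution p s Ω H f u)
    (hw : MemW0 p Ω w) (hG : IsWeakGradient u G) (hGp : MemLp G (ENNReal.ofReal p) volume)
    (hK : IsWeakGradient w K) (hKp : MemLp K (ENNReal.ofReal p) volume)
    (hu0 : ∀ᵐ x, 0 ≤ u x) (hw0 : ∀ᵐ x, 0 ≤ w x) :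
    (∫ x in Ω, diffQuotient p t f u w x)
      + 1 / p * ((∫ z, slack p s (1 - t) t u w z ∂(volume.prod volume)) / t)
      ≤ 1 / p * (energy p s Ω H w K - energy p s Ω H u G) := by
  have h := (hu.integral_le_energy_sub_slack hN hp hs₀ hs₁ (by linarith : 0 < 1 - t) ht0 (by ring)
    hH hw hG hGp hK hKp hu0 hw0).2
  simp only [diffQuotient, integral_div]
  have h' := div_le_div_of_nonneg_right h ht0.le
  have he : 1 / p * (t * (energy p s Ω H w K - energy p s Ω H u G)
        - ∫ z, slack p s (1 - t) t u w z ∂(volume.prod volume)) / t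
      = 1 / p * (energy p s Ω H w K - energy p s Ω H u G)
        - 1 / p * ((∫ z, slack p s (1 - t) t u w z ∂(volume.prod volume)) / t) := by
    field_simp
  rw [he] at h'
  linarith

theorem integrable_diffQuotient {N : ℕ} {p t : ℝ} (hp : 1 < p) (ht0 : 0 < t) (ht1 : t < 1)
    {Ω : Set (E N)} (hΩ : volume Ω ≠ ⊤) {f : E N → ℝ → ℝ} (hf : IsAdmissible p Ω f)
    {u w : E N → ℝ} {G K : E N → E N} (hup : MemLp u (ENNReal.ofReal p) volume)
    (hwp : MemLp w (ENNReal.ofReal p) volume) (hG : IsWeakGradient u G)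
    (hGp : MemLp G (ENNReal.ofReal p) volume)
    (hK : IsWeakGradient w K) (hKp : MemLp K (ENNReal.ofReal p) volume)
    (hu0 : ∀ᵐ x, 0 ≤ u x) (hw0 : ∀ᵐ x, 0 ≤ w x) :
    Integrable (diffQuotient p t f u w) (volume.restrict Ω) := by
  have hσ := (IsWeakGradient.pmean hp (by linarith : 0 < 1 - t) ht0 (by ring) hG hK hup hwp
    hGp hKp hu0 hw0).2.1
  exact (hf.integrable_mul hp hΩ hup (hσ.sub hup) hu0).div_const t

/-- Two weak solutions have the same zeros. This replaces the strong maximum principle: on a set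
where `u = 0 < w` the nonlocal slack would dominate the other terms of the energy inequality. -/
theorem IsWeakSolution.ae_eq_zero_imp {N : ℕ} (hN : 1 ≤ N) {p s : ℝ}
    (hp : 1 < p) (hs₀ : 0 < s) (hs₁ : s < 1) {Ω : Set (E N)} (hΩm : MeasurableSet Ω)
    (hΩ : volume Ω ≠ ⊤) {H : E N → ℝ} (hH : IsFinslerMinkowskiNorm H)
    {f : E N → ℝ → ℝ} (hf : IsAdmissible p Ω f) {u w : E N → ℝ}
    (hu : IsWeakSolution p s Ω H f u) (hw : MemW0 p Ω w) (hw0 : ∀ᵐ x, 0 ≤ w x) :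
    ∀ᵐ x, u x = 0 → w x = 0 := by
  have hp0 : 0 < p := by linarith
  have hu0 := hu.ae_nonneg hΩm
  obtain ⟨G, hG, hGp⟩ := hu.mem.exists_grad
  obtain ⟨K, hK, hKp⟩ := hw.exists_grad
  obtain ⟨L, hL, hLle⟩ := hf.exists_minorant hp hΩ hu.mem.memLp hw.memLp hu0 hw0
  set A : Set (E N) := {x | u x = 0 ∧ 0 < w x}
  set B : Set (E N) := {x | 0 < u x}
  have hum := hu.mem.memLp.1.aemeasurable
  have hwm := hw.memLp.1.aemeasurable
  have hAm : NullMeasurableSet A volume :=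
    (hum.nullMeasurableSet_preimage (measurableSet_singleton 0)).inter
      (hwm.nullMeasurableSet_preimage measurableSet_Ioi)
  have hBm : NullMeasurableSet B volume := hum.nullMeasurableSet_preimage measurableSet_Ioi
  have hBpos : volume B ≠ 0 := (hu.pos.trans_le (measure_mono fun x hx => hx.2)).ne'
  have hDm : NullMeasurableSet (A ×ˢ B) ((volume : Measure (E N)).prod volume) := hAm.prod hBm
  have ht0 : ∀ n, 0 < stepSize n ^ p := fun n => Real.rpow_pos_of_pos (stepSize_pos n) p
  have ht1 : ∀ n, stepSize n ^ p < 1 :=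
    fun n => Real.rpow_lt_one (stepSize_pos n).le (stepSize_lt_one n) hp0
  have hS : ∀ n, Integrable (slack p s (1 - stepSize n ^ p) (stepSize n ^ p) u w)
      (volume.prod volume) := fun n =>
    (hu.integral_le_energy_sub_slack hN hp hs₀ hs₁ (by linarith [ht1 n]) (ht0 n) (by ring)
      hH hw hG hGp hK hKp hu0 hw0).1
  have hS0 : ∀ n, ∀ᵐ z ∂((volume : Measure (E N)).prod volume),
      0 ≤ slack p s (1 - stepSize n ^ p) (stepSize n ^ p) u w z := fun n =>
    slack_nonneg hp (by linarith [ht1 n]) (ht0 n) (by ring) hu0 hw0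
  set C : ℝ := energy p s Ω H w K - energy p s Ω H u G - p * ∫ x in Ω, L x with hC
  -- Here `p > 1` enters: the bound `∬ slack ≤ C t` with `t = τ ^ p` is `o(τ)`.
  have hbound : ∀ n, ∫ z in A ×ˢ B, slack p s (1 - stepSize n ^ p) (stepSize n ^ p) u w z
      / stepSize n ∂(volume.prod volume) ≤ stepSize n ^ (p - 1) * C := by
    intro n
    have hτ := stepSize_pos n
    have h1 := hu.integral_diffQuotient_add_le hN hp hs₀ hs₁ (ht0 n) (ht1 n) hH hw hG hGp hK hKp
      hu0 hw0
    have h2 : ∫ x in Ω, L x ≤ ∫ x in Ω, diffQuotient p (stepSize n ^ p) f u w x :=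
      integral_mono_ae hL (integrable_diffQuotient hp (ht0 n) (ht1 n) hΩ hf hu.mem.memLp
        hw.memLp hG hGp hK hKp hu0 hw0) (hLle _ (ht0 n) (ht1 n))
    have h3 : ∫ z in A ×ˢ B, slack p s (1 - stepSize n ^ p) (stepSize n ^ p) u w z
        ∂(volume.prod volume)
        ≤ ∫ z, slack p s (1 - stepSize n ^ p) (stepSize n ^ p) u w z ∂(volume.prod volume) :=
      setIntegral_le_integral (hS n) (hS0 n)
    set I := ∫ z, slack p s (1 - stepSize n ^ p) (stepSize n ^ p) u w z ∂(volume.prod volume)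
    have h4 : I / stepSize n ^ p ≤ C := by
      have h5 : 1 / p * (I / stepSize n ^ p) ≤ 1 / p * C := by
        rw [hC, mul_sub, ← mul_assoc (1 / p) p, one_div_mul_cancel hp0.ne', one_mul]
        linarith
      exact le_of_mul_le_mul_left h5 (by positivity)
    rw [integral_div]
    calc _ ≤ I / stepSize n := by gcongr
      _ = stepSize n ^ (p - 1) * (I / stepSize n ^ p) := by
          rw [Real.rpow_sub_one hτ.ne']
          have := (ht0 n).ne'
          field_simp
      _ ≤ _ := by gcongr
  have hlim0 : Tendsto (fun n => stepSize n ^ (p - 1) * C) atTop (𝓝 0) := by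
    have h := (tendsto_nhds_of_tendsto_nhdsWithin tendsto_stepSize).rpow_const
      (p := p - 1) (Or.inr (by linarith))
    rw [Real.zero_rpow (by linarith)] at h
    simpa using h.mul_const C
  set g : E N × E N → ℝ := fun z =>
    p * u z.2 ^ (p - 1) * w z.1 * ‖z.1 - z.2‖ ^ (-(N : ℝ) - p * s) with hg
  have hgpos : ∀ z ∈ A ×ˢ B, 0 < g z := by
    rintro ⟨x, y⟩ ⟨⟨hx0, hxw⟩, hy⟩
    have hy' : 0 < u y := hy
    have hxw' : 0 < w x := hxw
    -- The kernel has the value `0` on the diagonal, which the product `A ×ˢ B` avoids.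
    have hne : 0 < ‖x - y‖ := by
      rw [norm_pos_iff, sub_ne_zero]
      rintro rfl
      exact hy'.ne' hx0
    simp only [hg]
    positivity
  obtain ⟨hgi, hgle⟩ := integrable_and_integral_le_of_tendsto
    (μ := ((volume : Measure (E N)).prod volume).restrict (A ×ˢ B)) (L := fun _ => 0) (G := g)
    (fun n => ((hS n).div_const (stepSize n)).restrict) (integrable_zero _ _ _)
    (fun n => ae_restrict_of_ae (by
      filter_upwards [hS0 n] with z hz
      exact div_nonneg hz (stepSize_pos n).le))
    ((ae_restrict_iff'₀ hDm).2 (Eventually.of_forall fun z hz => by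
      have h := ((tendsto_slack_div hp hz.2 hz.1.2 (w z.2)).comp tendsto_stepSize).mul_const
        (‖z.1 - z.2‖ ^ (-(N : ℝ) - p * s))
      refine h.congr fun n => ?_
      simp only [Function.comp_apply, slack_eq, hz.1.1]
      ring)) hbound hlim0
  have hg0 : ∀ᵐ z ∂((volume : Measure (E N)).prod volume).restrict (A ×ˢ B), 0 < g z :=
    (ae_restrict_iff'₀ hDm).2 (Eventually.of_forall hgpos)
  have hgz := (integral_eq_zero_iff_of_nonneg_ae
    (by filter_upwards [hg0] with z hz using hz.le) hgi).1
    (le_antisymm hgle (integral_nonneg_of_ae (by filter_upwards [hg0] with z hz using hz.le)))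
  have hfalse : ∀ᵐ z ∂((volume : Measure (E N)).prod volume).restrict (A ×ˢ B), False := by
    filter_upwards [hg0, hgz] with z h1 h2
    exact h1.ne' h2
  have hD : ((volume : Measure (E N)).prod volume) (A ×ˢ B) = 0 := by
    rw [← Measure.restrict_eq_zero, ← ae_eq_bot]
    exact Filter.eventually_false_iff_eq_bot.1 hfalse
  rw [Measure.prod_prod, mul_eq_zero, or_iff_left hBpos] at hD
  have hA' : ∀ᵐ x, x ∉ A := measure_eq_zero_iff_ae_notMem.1 hD
  filter_upwards [hA', hw0] with x h1 h2 h3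
  by_contra h4
  exact h1 ⟨h3, h2.lt_of_ne' h4⟩

/-- The integrand obtained in the limit is positive where the two solutions differ. -/
theorem strictAnti_mul_rpow_sub_pos {p a b : ℝ} {φ : ℝ → ℝ} (hp : 1 < p)
    (hφ : StrictAntiOn (fun t : ℝ => φ t / t ^ (p - 1)) (Ioi 0)) (ha : 0 < a) (hb : 0 < b)
    (hab : a ≠ b) : 0 < (φ a / a ^ (p - 1) - φ b / b ^ (p - 1)) * (b ^ p - a ^ p) := by
  rcases lt_or_gt_of_ne hab with h | h
  · exact mul_pos (sub_pos.2 (hφ ha hb h)) (sub_pos.2 (Real.rpow_lt_rpow ha.le h (by linarith)))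
  · exact mul_pos_of_neg_of_neg (sub_neg.2 (hφ hb ha h))
      (sub_neg.2 (Real.rpow_lt_rpow hb.le h (by linarith)))

/-- Adding the energy inequalities of two weak solutions, the energies cancel, and the monotonicity
of `f(x,t) / t^{p-1}` forces equality almost everywhere. -/
theorem IsWeakSolution.ae_eq {N : ℕ} (hN : 1 ≤ N) {p s : ℝ}
    (hp : 1 < p) (hs₀ : 0 < s) (hs₁ : s < 1) {Ω : Set (E N)} (hΩm : MeasurableSet Ω)
    (hΩ : volume Ω ≠ ⊤) {H : E N → ℝ} (hH : IsFinslerMinkowskiNorm H)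
    {f : E N → ℝ → ℝ} (hf : IsAdmissible p Ω f) {u w : E N → ℝ}
    (hu : IsWeakSolution p s Ω H f u) (hw : IsWeakSolution p s Ω H f w) :
    u =ᵐ[volume] w := by
  have hp0 : 0 < p := by linarith
  have hu0 := hu.ae_nonneg hΩm
  have hw0 := hw.ae_nonneg hΩm
  obtain ⟨G, hG, hGp⟩ := hu.mem.exists_grad
  obtain ⟨K, hK, hKp⟩ := hw.mem.exists_grad
  obtain ⟨L, hL, hLle⟩ := hf.exists_minorant hp hΩ hu.mem.memLp hw.mem.memLp hu0 hw0
  obtain ⟨L', hL', hLle'⟩ := hf.exists_minorant hp hΩ hw.mem.memLp hu.mem.memLp hw0 hu0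
  have hz1 := hu.ae_eq_zero_imp hN hp hs₀ hs₁ hΩm hΩ hH hf hw.mem hw0
  have hz2 := hw.ae_eq_zero_imp hN hp hs₀ hs₁ hΩm hΩ hH hf hu.mem hu0
  have ht0 := stepSize_pos
  have ht1 := stepSize_lt_one
  have hi : ∀ n, Integrable (diffQuotient p (stepSize n) f u w) (volume.restrict Ω) := fun n =>
    integrable_diffQuotient hp (ht0 n) (ht1 n) hΩ hf hu.mem.memLp hw.mem.memLp hG hGp hK hKp
      hu0 hw0
  have hi' : ∀ n, Integrable (diffQuotient p (stepSize n) f w u) (volume.restrict Ω) := fun n =>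
    integrable_diffQuotient hp (ht0 n) (ht1 n) hΩ hf hw.mem.memLp hu.mem.memLp hK hKp hG hGp
      hw0 hu0
  set g : E N → ℝ := fun x =>
    1 / p * ((f x (u x) / u x ^ (p - 1) - f x (w x) / w x ^ (p - 1)) * (w x ^ p - u x ^ p)) with hg
  have hbound : ∀ n, ∫ x in Ω, diffQuotient p (stepSize n) f u w x
      + diffQuotient p (stepSize n) f w u x ≤ 0 := by
    intro n
    have h1 := hu.integral_diffQuotient_add_le hN hp hs₀ hs₁ (ht0 n) (ht1 n) hH hw.mem hG hGp hK hKp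
      hu0 hw0
    have h2 := hw.integral_diffQuotient_add_le hN hp hs₀ hs₁ (ht0 n) (ht1 n) hH hu.mem hK hKp hG hGp
      hw0 hu0
    have hs1 : 0 ≤ 1 / p * ((∫ z, slack p s (1 - stepSize n) (stepSize n) u w z
        ∂(volume.prod volume)) / stepSize n) :=
      mul_nonneg (by positivity) (div_nonneg (integral_nonneg_of_ae
        (slack_nonneg hp (by linarith [ht1 n]) (ht0 n) (by ring) hu0 hw0)) (ht0 n).le)
    have hs2 : 0 ≤ 1 / p * ((∫ z, slack p s (1 - stepSize n) (stepSize n) w u z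
        ∂(volume.prod volume)) / stepSize n) :=
      mul_nonneg (by positivity) (div_nonneg (integral_nonneg_of_ae
        (slack_nonneg hp (by linarith [ht1 n]) (ht0 n) (by ring) hw0 hu0)) (ht0 n).le)
    rw [integral_add (hi n) (hi' n)]
    linarith
  obtain ⟨hgi, hgle⟩ := integrable_and_integral_le_of_tendsto (μ := volume.restrict Ω)
    (L := fun x => L x + L' x) (G := g) (fun n => (hi n).add (hi' n)) (hL.add hL')
    (fun n => by
      filter_upwards [hLle _ (ht0 n) (ht1 n), hLle' _ (ht0 n) (ht1 n)] with x h1 h2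
      exact add_le_add h1 h2)
    (by
      filter_upwards [ae_restrict_of_ae hu0, ae_restrict_of_ae hw0, ae_restrict_of_ae hz1,
        ae_restrict_of_ae hz2] with x h1 h2 h3 h4
      rcases h1.eq_or_lt with hux | hux
      · have hwx := h3 hux.symm
        refine tendsto_const_nhds.congr fun n => ?_
        simp only [hg, diffQuotient, Pi.add_apply, ← hux, hwx,
          pmean_diag hp (sub_add_cancel 1 (stepSize n)) le_rfl]
        simp
      · have hwx : 0 < w x := h2.lt_of_ne' fun h => hux.ne' (h4 h)
        have l1 := ((tendsto_pmean_sub_div (b := w x) hp hux).comp tendsto_stepSize).const_mul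
          (f x (u x))
        have l2 := ((tendsto_pmean_sub_div (b := u x) hp hwx).comp tendsto_stepSize).const_mul
          (f x (w x))
        have hval : f x (u x) * ((w x ^ p - u x ^ p) / (p * u x ^ (p - 1)))
            + f x (w x) * ((u x ^ p - w x ^ p) / (p * w x ^ (p - 1))) = g x := by
          have h5 : 0 < u x ^ (p - 1) := by positivity
          have h6 : 0 < w x ^ (p - 1) := by positivity
          simp only [hg]
          field_simp
          ring
        rw [← hval]
        refine (l1.add l2).congr fun n => ?_
        simp only [Function.comp_apply, diffQuotient, Pi.add_apply]
        ring)
    hbound tendsto_const_nhds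
  have hgpos : ∀ᵐ x ∂(volume.restrict Ω), 0 ≤ g x ∧ (g x = 0 → u x = w x) := by
    filter_upwards [ae_restrict_of_ae hu0, ae_restrict_of_ae hw0, ae_restrict_of_ae hz1,
      ae_restrict_of_ae hz2, hf.strictAnti] with x h1 h2 h3 h4 h5
    by_cases heq : u x = w x
    · simp [hg, heq]
    · have hux : 0 < u x := h1.lt_of_ne' fun h => heq (h.trans (h3 h).symm)
      have hwx : 0 < w x := h2.lt_of_ne' fun h => hux.ne' (h4 h)
      have : 0 < g x := mul_pos (by positivity) (strictAnti_mul_rpow_sub_pos hp h5 hux hwx heq)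
      exact ⟨this.le, fun h => absurd h this.ne'⟩
  have hg0 : 0 ≤ᵐ[volume.restrict Ω] g := by filter_upwards [hgpos] with x hx using hx.1
  have hgz := (integral_eq_zero_iff_of_nonneg_ae hg0 hgi).1
    (le_antisymm hgle (integral_nonneg_of_ae hg0))
  have hΩeq : ∀ᵐ x ∂(volume.restrict Ω), u x = w x := by
    filter_upwards [hgpos, hgz] with x h1 h2 using h1.2 h2
  filter_upwards [(ae_restrict_iff' hΩm).1 hΩeq, hu.mem.eq_zero, hw.mem.eq_zero] with x h1 h2 h3
  by_cases hx : x ∈ Ω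
  · exact h1 hx
  · rw [h2 hx, h3 hx]

end BrezisOswald

theorem mainTheorem2 (N : ℕ) (hN : 2 ≤ N) (p s : ℝ) (hp : 1 < p) (hs₀ : 0 < s) (hs₁ : s < 1)
    (Ω : Set (BrezisOswald.E N)) (hΩ : BrezisOswald.IsBoundedC1Domain Ω)
    (H : BrezisOswald.E N → ℝ) (hH : BrezisOswald.IsFinslerMinkowskiNorm H)
    (f : BrezisOswald.E N → ℝ → ℝ) (hf : BrezisOswald.IsAdmissible p Ω f)
    (u v : BrezisOswald.E N → ℝ)
    (hu : BrezisOswald.IsWeakSolution p s Ω H f u)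
    (hv : BrezisOswald.IsWeakSolution p s Ω H f v) :
    u =ᵐ[(volume : Measure (BrezisOswald.E N))] v :=
  hu.ae_eq (by omega) hp hs₀ hs₁ hΩ.isOpen.measurableSet hΩ.isBounded.measure_lt_top.ne hH hf hv
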